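/- \textbf{Setting.} Let $\mathfrak C$ be a saturated first-order structure (the monster model of a complete theory $T$ in a language $L$): for every $B\subseteq\mathfrak C$ with $|B|<|\mathfrak C|$, every complete $1$-type over $B$ is realized in $\mathfrak C$. Let $A\subseteq\mathfrak C$ with $|A|<|\mathfrak C|$; "model" means elementary substructure $M$ of $\mathfrak C$. For $p\in S_1(A)$ let $p(\mathfrak C)$ be its set of realizations and $p(N)=p(\mathfrak C)\cap N$ for $N\subseteq\mathfrak C$. A formula $\varphi(x,\bar b)$, with $\varphi(x,\bar y)$ over $A$, \emph{divides} over $A$ if for some sequence $(\bar b_i)_{i<\omega}$ of realizations of $\mathrm{tp}(\bar b/A)$ and some $k$, no $k$ of the instances $\varphi(x,\bar b_i)$ (with distinct indices) are jointly consistent; a formula \emph{forks} over $A$ if it implies a finite disjunction of formulas dividing over $A$; a type forks over $A$ if it implies a formula that forks over $A$. Write $a\not\perp_A b$ ("$a$ depends on $b$ over $A$") if $\mathrm{tp}(a/Ab)$ forks over $A$. Types $p,q\in S_1(A)$ are \emph{weakly orthogonal} if $p(x)\cup q(y)$ determines a complete type over $A$, and \emph{forking orthogonal} if no realization of $p$ depends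 over $A$ on a realization of $q$. An \emph{so-pair} over $A$ is $\mathbf p=(p,<_p)$, where $p\in S_1(A)$ and $(D_p,<_p)$ is an $A$-definable linear order with $p(\mathfrak C)\subseteq D_p$, such that for every $\mathfrak C$-definable set $D$ one of $D$, $\mathfrak C\smallsetminus D$ contains a non-empty initial part, and one of them contains a non-empty final part, of $(p(\mathfrak C),<_p)$. It is a \emph{convex so-pair} if $p(\mathfrak C)$ is convex in $(D_p,<_p)$. A type $p\in S_1(A)$ is \emph{convex} if $p(\mathfrak C)$ is a convex subset of some $A$-definable linear order containing it. For $b\in\mathfrak C$ let $\mathcal L_{\mathbf p}(b)$ be the set of elements that lie in every $Ab$-definable set containing a non-empty initial part of $(p(\mathfrak C),<_p)$. So-pairs $\mathbf p,\mathbf q$ over $A$ are \emph{directly non-orthogonal}, $\delta(\mathbf p,\mathbf q)$, if $p,q$ are not weakly orthogonal and $\mathcal L_{\mathbf q}(a_1)\subseteq\mathcal L_{\mathbf q}(a_2)$ for all $a_1<_pa_2$ realizing $p$; they are \emph{directly shuffled} if moreover $p$ and $q$ are forking orthogonal. Let $S_{\mathbf p,\mathbf q}=\{(x,y)\in p(\mathfrak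 C)\times q(\mathfrak C)\mid x\in\mathcal L_{\mathbf p}(y)\}$. For $N\subseteq\mathfrak C$ let $\mathcal D_p^N$ be the relation $x\not\perp_Ay$ on $p(N)$, and for $a\in\mathfrak C$ let $\mathcal D_p^N(a)=\{x\in p(N)\mid x\not\perp_A a\}$; put $p(N)/\mathcal D_p^N=\{\mathcal D_p^N(a)\mid a\in p(N)\}$ and, for classes $X,Y$, let $X<_pY$ mean $x<_py$ for all $x\in X$, $y\in Y$. If this is a linear order, its order type is the invariant $\mathrm{Inv}_{\mathbf p}(N)$ (which is $\mathbf 0$ if $p(N)=\emptyset$). A \emph{shuffling relation} between linear orders $(P,<_P)$ and $(Q,<_Q)$ is a non-empty $S\subseteq P\times Q$ such that $(\{x\in P\mid (x,b)\in S\})_{b\in Q}$ is a strictly increasing family of initial parts of $P$, none of which has a supremum in $P$ (a supremum of $\emptyset$ being a minimum of $P$), and $(\{y\in Q\mid (a,y)\in S\})_{a\in P}$ is a strictly decreasing family of final parts of $Q$. \textbf{Theorem.} Let $\mathbf p=(p,<_p)$ and $\mathbf q=(q,<_q)$ be so-pairs over $A$ with $\delta(\mathbf p,\mathbf q)$. Then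 for every $N\subseteq\mathfrak C$ the relations $\mathcal D_p^N$, $\mathcal D_q^N$ are equivalence relations on $p(N)$, $q(N)$, and the quotients $(p(N)/\mathcal D_p^N,<_p)$, $(q(N)/\mathcal D_q^N,<_q)$ are linear orders. Moreover: (1) Suppose that $p$ and $q$ are not forking orthogonal. (a) The mapping $\mathcal D_p^{\mathfrak C}(x)\mapsto\mathcal D_q^{\mathfrak C}(x)$ $(x\in p(\mathfrak C))$ is a well-defined isomorphism between $(p(\mathfrak C)/\mathcal D_p^{\mathfrak C},<_p)$ and $(q(\mathfrak C)/\mathcal D_q^{\mathfrak C},<_q)$. (b) If $p$ and $q$ are convex types and $M\supseteq A$ is a model, then $\mathcal D_p^M(x)\mapsto\mathcal D_q^M(x)$ $(x\in p(M))$ is a well-defined isomorphism between $(p(M)/\mathcal D_p^M,<_p)$ and $(q(M)/\mathcal D_q^M,<_q)$, and $\mathrm{Inv}_{\mathbf p}(M)=\mathrm{Inv}_{\mathbf q}(M)$. (2) Suppose that $\mathbf p$ and $\mathbf q$ are directly shuffled convex so-pairs and $M\supseteq A$ is a model, and let $\hat S^M_{\mathbf p,\mathbf q}=\{(\mathcal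 D_p^M(a),\mathcal D_q^M(b))\mid a\in p(M),\ b\in q(M),\ (a,b)\in S_{\mathbf p,\mathbf q}\}$. (a) If $|q(M)/\mathcal D_q^M|\ge 2$, then the orders $(p(M)/\mathcal D_p^M,<_p)$ and $(q(M)/\mathcal D_q^M,<_q)$ are infinite and $\hat S^M_{\mathbf p,\mathbf q}$ is a shuffling relation between them. (b) If $|q(M)/\mathcal D_q^M|=1$, then $p$ is omitted in $M$. -/

import Mathlib

open FirstOrder Cardinal

universe u v w

namespace StatOrd

/-! ### Shuffling relations between linear orders -/

/-- `a` is a supremum of `X` with respect to the strict order `r`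
(so a supremum of the empty set is a minimum of the order). -/
def IsSupOf {α : Type*} (r : α → α → Prop) (X : Set α) (a : α) : Prop :=
  (∀ x ∈ X, r x a ∨ x = a) ∧ ∀ b, (∀ x ∈ X, r x b ∨ x = b) → r a b ∨ a = b

def IsInitialPart {α : Type*} (r : α → α → Prop) (X : Set α) : Prop :=
  ∀ x ∈ X, ∀ y, r y x → y ∈ X

def IsFinalPart {α : Type*} (r : α → α → Prop) (X : Set α) : Prop :=
  ∀ x ∈ X, ∀ y, r x y → y ∈ X

/-- `S` is a shuffling relation between the (strict) linear orders `(α, r)` and `(β, s)`. -/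
structure IsShuffling {α β : Type*} (r : α → α → Prop) (s : β → β → Prop)
    (S : α → β → Prop) : Prop where
  left_order : IsStrictTotalOrder α r
  right_order : IsStrictTotalOrder β s
  nonempty : ∃ a b, S a b
  initial : ∀ b, IsInitialPart r {a | S a b}
  initial_strict : ∀ b b', s b b' → {a | S a b} ⊂ {a | S a b'}
  no_sup : ∀ b, ¬ ∃ a, IsSupOf r {a | S a b} a
  final : ∀ a, IsFinalPart s {b | S a b}
  final_strict : ∀ a a', r a a' → {b | S a' b} ⊂ {b | S a b}

section Types

variable (L : FirstOrder.Language.{u, v}) {C : Type w} [L.Structure C] [Nonempty C]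

/-! ### Types over parameter sets of `C` -/

/-- The space `S_n(A)` of complete `n`-types over `A ⊆ C`. -/
abbrev TypeOver (A : Set C) (n : ℕ) : Type _ :=
  ((L[[A]]).completeTheory C).CompleteType (Fin n)

/-- `tp(b / A)`. -/
def tp (A : Set C) {n : ℕ} (b : Fin n → C) : TypeOver L A n :=
  ((L[[A]]).completeTheory C).typeOf b

variable {L}

/-- The set `p(C)` of realizations of a complete `1`-type. -/
def locus {A : Set C} (p : TypeOver L A 1) : Set C :=
  {a | tp L A ![a] = p}

variable (L C)

/-- `C` is saturated: it realizes every complete `1`-type over every small parameter set. -/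
def IsSaturated : Prop :=
  ∀ A : Set C, #A < #C → ∀ p : TypeOver L A 1, (locus p).Nonempty

variable {C}

/-! ### Dividing and forking -/

/-- The formula `φ(x, b)` divides over `A`; the variable `x` has index `0` and the
remaining variables are for the tuple `b`. -/
def FormulaDivides (A : Set C) {n : ℕ} (φ : (L[[A]]).Formula (Fin (n + 1)))
    (b : Fin n → C) : Prop :=
  ∃ s : ℕ → Fin n → C, (∀ i, tp L A (s i) = tp L A b) ∧
    ∃ k : ℕ, ∀ I : Finset ℕ, I.card = k →
      ¬ ∃ x : C, ∀ i ∈ I, φ.Realize (Fin.cons x (s i) : Fin (n + 1) → C)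

/-- `X` is the solution set in `C` of a formula that divides over `A`. -/
def Divides (A : Set C) (X : Set C) : Prop :=
  ∃ (n : ℕ) (φ : (L[[A]]).Formula (Fin (n + 1))) (b : Fin n → C),
    X = {x | φ.Realize (Fin.cons x b : Fin (n + 1) → C)} ∧ FormulaDivides L A φ b

/-- A formula with solution set `X` forks over `A`: it implies a finite disjunction of
formulas that divide over `A`. -/
def Forks (A : Set C) (X : Set C) : Prop :=
  ∃ F : Set (Set C), F.Finite ∧ (∀ Y ∈ F, Divides L A Y) ∧ X ⊆ ⋃₀ F

/-- A type over `B` forks over `A`: it implies a formula (over `C`) that forks over `A`. -/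
def TypeForks (A : Set C) {B : Set C} (p : TypeOver L B 1) : Prop :=
  ∃ X : Set C, Set.univ.Definable₁ L X ∧ locus p ⊆ X ∧ Forks L A X

/-- `a` depends on `b` over `A`: the type `tp(a / A b)` forks over `A`. -/
def Dep (A : Set C) (a b : C) : Prop :=
  TypeForks L A (tp L (insert b A) ![a])

variable {L}

/-- Weak non-orthogonality: `p(x) ∪ q(y)` does not determine a complete type over `A`. -/
def WeakNonorth {A : Set C} (p q : TypeOver L A 1) : Prop :=
  ¬ ∀ a ∈ locus p, ∀ a' ∈ locus p, ∀ b ∈ locus q, ∀ b' ∈ locus q,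
    tp L A ![a, b] = tp L A ![a', b']

/-- Forking orthogonality. -/
def ForkOrth {A : Set C} (p q : TypeOver L A 1) : Prop :=
  ∀ a ∈ locus p, ∀ b ∈ locus q, ¬ Dep L A a b

variable (L)

/-! ### Ordered and stationarily ordered types -/

/-- An `A`-definable (strict) linear order `(dom, lt)`. -/
structure DefLinOrder (A : Set C) where
  dom : Set C
  lt : C → C → Prop
  dom_definable : A.Definable₁ L dom
  lt_definable : A.Definable₂ L {z : C × C | lt z.1 z.2}
  lt_dom : ∀ x y, lt x y → x ∈ dom ∧ y ∈ dom
  irrefl : ∀ x, ¬ lt x x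
  trans : ∀ x y z, lt x y → lt y z → lt x z
  total : ∀ x ∈ dom, ∀ y ∈ dom, lt x y ∨ x = y ∨ lt y x

variable {L}

/-- The order witnesses that `p` is a convex type. -/
def DefLinOrder.WitnessesConvex {A : Set C} (O : DefLinOrder L A) (p : TypeOver L A 1) : Prop :=
  locus p ⊆ O.dom ∧
    ∀ x ∈ locus p, ∀ z ∈ locus p, ∀ y, O.lt x y → O.lt y z → y ∈ locus p

/-- `p` is a convex type. -/
def IsConvexType {A : Set C} (p : TypeOver L A 1) : Prop :=
  ∃ O : DefLinOrder L A, O.WitnessesConvex p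

/-- `D` contains a (non-empty) initial part of `(P, lt)`. -/
def LeftEventual (P : Set C) (lt : C → C → Prop) (D : Set C) : Prop :=
  ∃ a ∈ P, ∀ x ∈ P, (lt x a ∨ x = a) → x ∈ D

/-- `D` contains a (non-empty) final part of `(P, lt)`. -/
def RightEventual (P : Set C) (lt : C → C → Prop) (D : Set C) : Prop :=
  ∃ a ∈ P, ∀ x ∈ P, (lt a x ∨ x = a) → x ∈ D

variable (L)

/-- A stationarily ordered pair over `A`: a complete `1`-type together with an
`A`-definable linear order that stationarily orders it. -/
structure SOPair (A : Set C) where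
  type : TypeOver L A 1
  ord : DefLinOrder L A
  locus_subset : locus type ⊆ ord.dom
  left : ∀ D : Set C, Set.univ.Definable₁ L D →
    LeftEventual (locus type) ord.lt D ∨ LeftEventual (locus type) ord.lt Dᶜ
  right : ∀ D : Set C, Set.univ.Definable₁ L D →
    RightEventual (locus type) ord.lt D ∨ RightEventual (locus type) ord.lt Dᶜ

variable {L}

namespace SOPair

variable {A : Set C}

/-- A convex stationarily ordered pair: `p(C)` is convex in the witnessing order. -/
def IsConvex (p : SOPair L A) : Prop := p.ord.WitnessesConvex p.type

/-- The set of realizations of the restriction to `B` of the left globalization of `p`,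
the global type of all formulas whose solution set is left eventual. -/
def leftLocus (p : SOPair L A) (B : Set C) : Set C :=
  {a | ∀ X : Set C, B.Definable₁ L X → LeftEventual (locus p.type) p.ord.lt X → a ∈ X}

/-- The set `L_p(b)` of realizations of the left globalization of `p` over `A b`. -/
def below (p : SOPair L A) (b : C) : Set C := p.leftLocus (insert b A)

/-- Direct non-orthogonality `δ(p, q)`. -/
def DirectNonorth (p q : SOPair L A) : Prop :=
  WeakNonorth p.type q.type ∧
    ∀ a₁ ∈ locus p.type, ∀ a₂ ∈ locus p.type, p.ord.lt a₁ a₂ → q.below a₁ ⊆ q.below a₂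

/-- The pairs are directly shuffled: they are directly non-orthogonal and their types are
weakly non-orthogonal and forking orthogonal. -/
def DirectlyShuffled (p q : SOPair L A) : Prop :=
  p.DirectNonorth q ∧ WeakNonorth p.type q.type ∧ ForkOrth p.type q.type

/-- The relation `S_{p,q}` on `p(C) × q(C)`: `x ∈ L_p(y)`. -/
def S (p q : SOPair L A) (x y : C) : Prop :=
  x ∈ locus p.type ∧ y ∈ locus q.type ∧ x ∈ p.below y

/-- The set `p(N)` of realizations of `p` in `N`. -/
def locusIn (p : SOPair L A) (N : Set C) : Set C := locus p.type ∩ N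

/-- The relation `D_p` restricted to `p(N)`. -/
def depOn (p : SOPair L A) (N : Set C) (x y : p.locusIn N) : Prop := Dep L A x.1 y.1

/-- The set of all elements of `p(N)` that depend on `a` over `A`; for `a` in `p(N)` this is
the class of `a` with respect to `D_p` on `p(N)`. -/
def cls (p : SOPair L A) (N : Set C) (a : C) : Set C := {x | x ∈ p.locusIn N ∧ Dep L A x a}

/-- The set `p(N)/D_p` of classes. -/
def classes (p : SOPair L A) (N : Set C) : Set (Set C) := {X | ∃ a ∈ p.locusIn N, X = p.cls N a}

/-- The order induced on the classes: all elements of the first class are below all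
elements of the second. -/
def classLT (p : SOPair L A) (N : Set C) (X Y : p.classes N) : Prop :=
  ∀ x ∈ X.1, ∀ y ∈ Y.1, p.ord.lt x y

/-- The relation induced by `S_{p,q}` between `p(N)/D_p` and `q(N)/D_q`. -/
def SHat (p q : SOPair L A) (N : Set C) (X : p.classes N) (Y : q.classes N) : Prop :=
  ∃ a ∈ p.locusIn N, ∃ b ∈ q.locusIn N, p.S q a b ∧ X.1 = p.cls N a ∧ Y.1 = q.cls N b

/-- Dependence is an equivalence relation on `p(N)` and the classes are strictly linearly
ordered by the induced order. -/
def IsOrderedQuotient (p : SOPair L A) (N : Set C) : Prop :=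
  Equivalence (p.depOn N) ∧ IsStrictTotalOrder (p.classes N) (p.classLT N)

/-- The mapping from the class of `x` in `p(N)` to the set of all elements of `q(N)` that
depend on `x` is an isomorphism between the orders `p(N)/D_p` and `q(N)/D_q`. -/
def CanonicalIso (p q : SOPair L A) (N : Set C) : Prop :=
  ∃ f : p.classLT N ≃r q.classLT N, ∀ X : p.classes N, ∀ a ∈ p.locusIn N,
    X.1 = p.cls N a → (f X).1 = q.cls N a

/-- `τ` is the `p`-invariant of `N`, the order type of `p(N)/D_p` (zero if `p(N)` is empty). -/
def HasInvariant (p : SOPair L A) (N : Set C) (τ : OrderType.{w}) : Prop :=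
  ∃ O : LinearOrder (p.classes N),
    (∀ X Y : p.classes N, O.lt X Y ↔ p.classLT N X Y) ∧ @OrderType.type (p.classes N) O = τ

end SOPair

end Types

end StatOrd

namespace StatOrd

open FirstOrder.Language Set

/-! ### Definable sets given by predicates -/

section Definability

variable {L : FirstOrder.Language.{u, v}} {C : Type w} [L.Structure C] {A B : Set C}
  {α : Type*} {P Q : (α → C) → Prop}

/-! An so-pair has a global type at each end of `p(C)`. Both are invariant over `A`: by compactness,
that `φ(x, e)` holds on an initial part can be read off from the type over `A` of `e` together with
a bound (`Left.congr`). An invariant type contains no forking formula. Conversely, a realization of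
`p` that omits both end types over `Ac` lies in an `Ac`-definable set squeezed between two
realizations of `p`. Conjugates of this set can be laid out disjointly along the order, so it
divides. Hence `x` depends on `c` exactly when it realizes neither end type over `Ac` (`dep_iff`).

Failure of weak orthogonality yields an `A`-definable family of initial parts that properly cut
`q(C)`, indexed by `p(C)`. Such a family has a direction (`Fam.not_left_and_right`), `δ(p, q)`
forces it to be increasing, and combining members over many indices makes it monotone
(`DirectNonorth.linked`). Write `a ≺ b` (`Prec`) if no monotone family contains `b` at `a`. Families
can be composed and dualized, so `≺` is a strict weak order on the realizations of both types
together. It describes the end types (`mem_below_iff_prec`), so dependence is incomparability, which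
gives the ordered quotients.

Without forking orthogonality, homogeneity spreads one dependent pair over all realizations, and
matching dependent classes is the isomorphism. Inside a model, dependence on `a` is witnessed by a
difference of two definable initial parts; convexity ensures that suitable points of the model in it
realize `q` (`exists_dep_in_model`). With forking orthogonality, no `a` and `b` from different types
are incomparable, so any one monotone family defines `≺` between the types. Points between given
ones are then found in the model, and this density gives the shuffling relation, the infinity of the
quotients, and a second class of `q(M)` as soon as `p` is realized. -/

theorem definable_and (hP : A.Definable L {v | P v}) (hQ : A.Definable L {v | Q v}) :
    A.Definable L {v | P v ∧ Q v} := hP.inter hQ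

theorem definable_or (hP : A.Definable L {v | P v}) (hQ : A.Definable L {v | Q v}) :
    A.Definable L {v | P v ∨ Q v} := hP.union hQ

theorem definable_not (hP : A.Definable L {v | P v}) : A.Definable L {v | ¬ P v} := hP.compl

theorem definable_imp (hP : A.Definable L {v | P v}) (hQ : A.Definable L {v | Q v}) :
    A.Definable L {v | P v → Q v} := by
  have := hP.compl.union hQ
  convert this using 1
  ext v
  simp [imp_iff_not_or]

theorem definable_exists {P : (α → C) → C → Prop}
    (h : A.Definable L {w : α ⊕ Unit → C | P (fun i => w (.inl i)) (w (.inr ()))}) :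
    A.Definable L {v | ∃ x, P v x} := by
  have := h.exists_of_finite
  convert this using 1
  ext v
  exact ⟨fun ⟨x, hx⟩ => ⟨fun _ => x, hx⟩, fun ⟨u, hu⟩ => ⟨u (), hu⟩⟩

theorem definable_forall {P : (α → C) → C → Prop}
    (h : A.Definable L {w : α ⊕ Unit → C | P (fun i => w (.inl i)) (w (.inr ()))}) :
    A.Definable L {v | ∀ x, P v x} := by
  have := h.forall_of_finite
  convert this using 1
  ext v
  exact ⟨fun h u => h (u ()), fun h x => h (fun _ => x)⟩

theorem definable_mem {X : Set C} (hX : A.Definable₁ L X) (hAB : A ⊆ B) {f : (α → C) → C}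
    (hf : B.DefinableFun L f) : B.Definable L {v | f v ∈ X} :=
  (Set.Definable.mono hX hAB).preimage_map (F := fun v => ![f v]) (by
    intro i; fin_cases i; exact hf)

theorem definable_rel {R : C → C → Prop} (hR : A.Definable₂ L {z : C × C | R z.1 z.2})
    (hAB : A ⊆ B) {f g : (α → C) → C} (hf : B.DefinableFun L f) (hg : B.DefinableFun L g) :
    B.Definable L {v | R (f v) (g v)} :=
  (Set.Definable.mono hR hAB).preimage_map (F := fun v => ![f v, g v]) (by
    intro i; fin_cases i; exacts [hf, hg])

theorem definable_le {R : C → C → Prop} (hR : A.Definable₂ L {z : C × C | R z.1 z.2})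
    (hAB : A ⊆ B) {f g : (α → C) → C} (hf : B.DefinableFun L f) (hg : B.DefinableFun L g) :
    B.Definable L {v | R (f v) (g v) ∨ f v = g v} :=
  definable_or (definable_rel hR hAB hf hg) (hf.ofPred_eq hg)

/-- Sets definable with finitely many additional parameters are slices of definable sets. -/
theorem definable_slice {n : ℕ} {D : Set (Fin (n + 1) → C)} (hD : A.Definable L D)
    (hAB : A ⊆ B) {e : Fin n → C} (he : ∀ i, e i ∈ B) :
    B.Definable₁ L {x | (Fin.cons x e : Fin (n + 1) → C) ∈ D} :=
  (hD.mono hAB).preimage_map (F := fun v : Fin 1 → C => (Fin.cons (v 0) e : Fin (n + 1) → C))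
    (by
      intro i
      refine Fin.cases ?_ (fun i => ?_) i
      · exact .proj L
      · exact L.definableFun_const _ (he i))

/-- Parameters from `A` stay constants; every other one becomes the variable of a coordinate of `e`
with that value. -/
theorem exists_slice {n : ℕ} {e : Fin n → C} {X : Set C}
    (hX : (A ∪ range e).Definable₁ L X) :
    ∃ D : Set (Fin (n + 1) → C), A.Definable L D ∧
      X = {x | (Fin.cons x e : Fin (n + 1) → C) ∈ D} := by
  classical
  obtain ⟨φ, hφ⟩ := definable_iff_exists_formula_sum.1 hX
  have hr : ∀ c : ↑(A ∪ range e), c.1 ∉ A → ∃ i, e i = c.1 := fun c hc =>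
    c.2.resolve_left hc
  choose k hk using hr
  let g : ↑(A ∪ range e) ⊕ Fin 1 → A ⊕ Fin (n + 1) :=
    Sum.elim (fun c => if h : c.1 ∈ A then .inl ⟨c.1, h⟩ else .inr (k c h).succ) (fun _ => .inr 0)
  refine ⟨_, definable_iff_exists_formula_sum.2 ⟨φ.relabel g, rfl⟩, ?_⟩
  ext x
  have hx : x ∈ X ↔ φ.Realize (Sum.elim (↑) ![x]) := by
    have := Set.ext_iff.1 hφ ![x]
    simpa using! this
  rw [hx]
  simp only [Set.mem_ofPred_eq, Formula.realize_relabel]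
  have : (Sum.elim (↑) ![x] : ↑(A ∪ range e) ⊕ Fin 1 → C) =
      (Sum.elim (↑) (Fin.cons x e : Fin (n + 1) → C) : A ⊕ Fin (n + 1) → C) ∘ g := by
    funext c
    rcases c with c | i
    · by_cases h : c.1 ∈ A
      · simp [g, h]
      · simp [g, h, hk c h]
    · have : i = 0 := Subsingleton.elim _ _
      subst this
      simp [g]
  rw [this]

theorem exists_rel_slice {a : C} {X : Set C} (hX : (insert a A).Definable₁ L X) :
    ∃ R : C → C → Prop, A.Definable₂ L {z : C × C | R z.1 z.2} ∧ X = {x | R a x} := by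
  have : insert a A = A ∪ range ![a] := by
    ext; simp [eq_comm]
  rw [this] at hX
  obtain ⟨D, hD, rfl⟩ := exists_slice hX
  refine ⟨fun y x => (![x, y] : Fin 2 → C) ∈ D, ?_, rfl⟩
  exact hD.preimage_map (F := fun v : Fin 2 → C => ![v 1, v 0]) (by
    intro i; fin_cases i; exacts [.proj L, .proj L])

theorem exists_finite_parameters {X : Set C} (hX : (univ : Set C).Definable₁ L X) :
    ∃ E : Set C, E.Finite ∧ E.Definable₁ L X := by
  obtain ⟨E, -, hE⟩ := definable_iff_finitely_definable.1 hX
  exact ⟨E, E.finite_toSet, hE⟩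

theorem definable₂_not {R : C → C → Prop} (hR : A.Definable₂ L {z : C × C | R z.1 z.2}) :
    A.Definable₂ L {z : C × C | ¬ R z.1 z.2} :=
  Set.Definable.compl hR

theorem definable₂_swap {R : C → C → Prop} (hR : A.Definable₂ L {z : C × C | R z.1 z.2}) :
    A.Definable₂ L {z : C × C | R z.2 z.1} :=
  definable_rel hR subset_rfl (.proj L) (.proj L)

theorem rel_definable {R : C → C → Prop} (hR : A.Definable₂ L {z : C × C | R z.1 z.2}) (a : C) :
    (univ : Set C).Definable₁ L {x | R a x} :=
  definable_rel hR (subset_univ _) (L.definableFun_const _ trivial) (.proj L)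

theorem rel_definable' {R : C → C → Prop} (hR : A.Definable₂ L {z : C × C | R z.1 z.2}) (a : C) :
    (univ : Set C).Definable₁ L {x | R x a} :=
  definable_rel hR (subset_univ _) (.proj L) (L.definableFun_const _ trivial)

theorem DefLinOrder.asymm (O : DefLinOrder L A) {x y : C} (h : O.lt x y) : ¬ O.lt y x :=
  fun h' => O.irrefl _ (O.trans _ _ _ h h')

variable (L) in
/-- Downward directed families of non-empty sets that are definable over `A` together with a
fixed finite set have a common element. -/
def CompactOver (A : Set C) : Prop :=
  ∀ E : Set C, E.Finite → ∀ F : Set (Set C), F.Nonempty → (∀ X ∈ F, (A ∪ E).Definable₁ L X) →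
    (∀ X ∈ F, ∀ Y ∈ F, X ∩ Y ∈ F) → (∀ X ∈ F, X.Nonempty) → (⋂₀ F).Nonempty

theorem CompactOver.insert (h : CompactOver L A) (b : C) : CompactOver L (insert b A) := by
  intro E hE F hF hd hi hn
  refine h (Set.insert b E) (hE.insert b) F hF (fun X hX => ?_) hi hn
  have := hd X hX
  rwa [Set.insert_union, ← Set.union_insert] at this

theorem exists_mem_subset_sInter {F : Set (Set C)} (hF : F.Nonempty)
    (hi : ∀ X ∈ F, ∀ Y ∈ F, X ∩ Y ∈ F) {s : Set (Set C)} (hs : s.Finite) (hsF : s ⊆ F) :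
    ∃ Y ∈ F, Y ⊆ ⋂₀ s := by
  induction s, hs using Set.Finite.induction_on with
  | empty => exact ⟨hF.some, hF.some_mem, by simp⟩
  | insert _ _ ih =>
    obtain ⟨Y, hY, hYs⟩ := ih ((Set.subset_insert _ _).trans hsF)
    refine ⟨_ ∩ Y, hi _ (hsF (Set.mem_insert _ _)) _ hY, ?_⟩
    rw [Set.sInter_insert]
    exact Set.inter_subset_inter_right _ hYs

end Definability

section Compactness

variable {L : FirstOrder.Language.{u, v}} {C : Type w} [L.Structure C] [Nonempty C] {A : Set C}

/-! ### Compactness and homogeneity -/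

theorem tp_eq_iff {n : ℕ} {e e' : Fin n → C} :
    tp L A e = tp L A e' ↔ ∀ D : Set (Fin n → C), A.Definable L D → (e ∈ D ↔ e' ∈ D) := by
  constructor
  · rintro h _ ⟨φ, rfl⟩
    have : Formula.equivSentence φ ∈ tp L A e ↔ Formula.equivSentence φ ∈ tp L A e' := by rw [h]
    simpa [tp] using this
  · intro h
    refine SetLike.ext fun φ => ?_
    simp only [tp, Theory.CompleteType.mem_typeOf]
    exact h _ ⟨_, rfl⟩

theorem tp_eq_rel {R : C → C → Prop} (hR : A.Definable₂ L {z : C × C | R z.1 z.2})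
    {a b a' b' : C} (h : tp L A ![a, b] = tp L A ![a', b']) : R a b ↔ R a' b' :=
  tp_eq_iff.1 h _ hR

theorem tp_eq_mem {X : Set C} (hX : A.Definable₁ L X)
    {a a' : C} (h : tp L A ![a] = tp L A ![a']) : a ∈ X ↔ a' ∈ X :=
  tp_eq_iff.1 h _ hX

theorem tp_eq_comp {n m : ℕ} {e e' : Fin n → C} (h : tp L A e = tp L A e') (f : Fin m → Fin n) :
    tp L A (e ∘ f) = tp L A (e' ∘ f) :=
  tp_eq_iff.2 fun _ hD => tp_eq_iff.1 h _ (hD.preimage_comp f)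

theorem tp_eq_one_iff {a a' : C} :
    tp L A ![a] = tp L A ![a'] ↔ ∀ X : Set C, A.Definable₁ L X → (a ∈ X ↔ a' ∈ X) := by
  refine ⟨fun h X hX => tp_eq_mem hX h, fun h => tp_eq_iff.2 fun D hD => ?_⟩
  refine h {x | ![x] ∈ D} ?_
  exact hD.preimage_map (F := fun v : Fin 1 → C => ![v 0]) (by
    intro i; fin_cases i; exact .proj L)

/-- A directed family has a member below any finitely many, so the formulas defining its members are
finitely satisfiable together with the theory of `C`. A completion is a type over `B`, which
saturation realizes. -/
theorem IsSaturated.sInter_nonempty (hC : IsSaturated L C) {B : Set C} (hB : #B < #C)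
    {F : Set (Set C)} (hF : F.Nonempty) (hd : ∀ X ∈ F, B.Definable₁ L X)
    (hi : ∀ X ∈ F, ∀ Y ∈ F, X ∩ Y ∈ F) (hn : ∀ X ∈ F, X.Nonempty) : (⋂₀ F).Nonempty := by
  let S : (L[[B]])[[Fin 1]].Theory :=
    {ψ | ∃ φ : L[[B]].Formula (Fin 1), {x | φ.Realize ![x]} ∈ F ∧ ψ = Formula.equivSentence φ}
  have key : {p : TypeOver L B 1 | S ⊆ ↑p} ≠ ∅ := by
    rw [Ne, Theory.CompleteType.setOfPred_subset_eq_empty_iff, not_not,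
      Theory.isSatisfiable_iff_isFinitelySatisfiable]
    intro T₀ hT₀
    classical
    let s : Set (Set C) := {X | ∃ φ : L[[B]].Formula (Fin 1), X = {x | φ.Realize ![x]} ∧
      X ∈ F ∧ Formula.equivSentence φ ∈ T₀}
    have hs : s.Finite := by
      refine (T₀.finite_toSet.image fun ψ => {x | (Formula.equivSentence.symm ψ).Realize ![x]}).subset ?_
      rintro _ ⟨φ, rfl, -, h⟩
      exact ⟨_, h, by simp⟩
    obtain ⟨Y, hY, hYs⟩ := exists_mem_subset_sInter hF hi hs (fun X hX => hX.choose_spec.2.1)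
    obtain ⟨a, ha⟩ := hn Y hY
    refine (tp L B ![a]).isMaximal.1.mono fun ψ hψ => ?_
    rcases hT₀ hψ with h | ⟨φ, hφ, rfl⟩
    · exact (tp L B ![a]).subset h
    · have : a ∈ {x | φ.Realize ![x]} := hYs ha _ ⟨φ, rfl, hφ, hψ⟩
      exact Theory.CompleteType.formula_mem_typeOf.2 this
  obtain ⟨p, hp⟩ := Set.nonempty_iff_ne_empty.2 key
  obtain ⟨a, ha⟩ := hC B hB p
  refine ⟨a, fun X hX => ?_⟩
  obtain ⟨φ, hφ⟩ := hd X hX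
  have hX' : X = {x | φ.Realize ![x]} := by
    ext x
    have := Set.ext_iff.1 hφ ![x]
    simpa using! this
  have : Formula.equivSentence φ ∈ tp L B ![a] := by
    rw [show tp L B ![a] = p from ha]
    exact hp ⟨φ, hX' ▸ hX, rfl⟩
  rw [hX']
  exact Theory.CompleteType.formula_mem_typeOf.1 this

theorem IsSaturated.compactOver (hC : IsSaturated L C) (hA : #A < #C) : CompactOver L A := by
  intro E hE F hF hd hi hn
  -- A finite structure has finitely many subsets, so the family has a least member; in an infinite
  -- one, finitely many extra parameters keep the parameter set small.
  rcases finite_or_infinite C with h | h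
  · obtain ⟨Y, hY, hYs⟩ := exists_mem_subset_sInter hF hi F.toFinite subset_rfl
    exact (hn Y hY).mono hYs
  · refine hC.sInter_nonempty ?_ hF hd hi hn
    refine (mk_union_le A E).trans_lt (add_lt_of_lt (aleph0_le_mk C) hA ?_)
    exact (lt_aleph0_iff_set_finite.2 hE).trans_le (aleph0_le_mk C)

/-- One back-and-forth step: the conditions on `x` over `e'` copied from those of `c` over `e` are
each consistent, because their existential closures belong to the common type. -/
theorem CompactOver.exists_extension (h : CompactOver L A) {n : ℕ} {e e' : Fin n → C}
    (he : tp L A e = tp L A e') (c : C) :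
    ∃ c', tp L A (Fin.cons c e : Fin (n + 1) → C) = tp L A (Fin.cons c' e' : Fin (n + 1) → C) := by
  let F : Set (Set C) := {X | ∃ D : Set (Fin (n + 1) → C), A.Definable L D ∧
    (Fin.cons c e : Fin (n + 1) → C) ∈ D ∧ X = {x | (Fin.cons x e' : Fin (n + 1) → C) ∈ D}}
  have : (⋂₀ F).Nonempty := by
    refine h (range e') (finite_range e') F ⟨_, univ, definable_univ, trivial, rfl⟩ ?_ ?_ ?_
    · rintro _ ⟨D, hD, -, rfl⟩
      exact definable_slice hD subset_union_left fun i => .inr ⟨i, rfl⟩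
    · rintro _ ⟨D, hD, h1, rfl⟩ _ ⟨D', hD', h2, rfl⟩
      exact ⟨D ∩ D', hD.inter hD', ⟨h1, h2⟩, rfl⟩
    · rintro _ ⟨D, hD, h1, rfl⟩
      have hex : A.Definable L {v : Fin n → C | ∃ x, (Fin.cons x v : Fin (n + 1) → C) ∈ D} := by
        refine definable_exists (hD.preimage_map (F := fun w : Fin n ⊕ Unit → C =>
          (Fin.cons (w (.inr ())) (fun i => w (.inl i)) : Fin (n + 1) → C)) ?_)
        intro i
        refine Fin.cases ?_ (fun i => ?_) i
        · exact .proj L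
        · exact .proj L
      exact (tp_eq_iff.1 he _ hex).1 ⟨c, h1⟩
  obtain ⟨c', hc'⟩ := this
  have key : ∀ D : Set (Fin (n + 1) → C), A.Definable L D → (Fin.cons c e : Fin (n + 1) → C) ∈ D →
      (Fin.cons c' e' : Fin (n + 1) → C) ∈ D := fun D hD hc => hc' _ ⟨D, hD, hc, rfl⟩
  refine ⟨c', tp_eq_iff.2 fun D hD => ⟨key D hD, fun hc => ?_⟩⟩
  by_contra hn
  exact key Dᶜ hD.compl hn hc

theorem mem_locus_iff {p : TypeOver L A 1} {a x : C} (ha : a ∈ locus p) :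
    x ∈ locus p ↔ tp L A ![a] = tp L A ![x] := by
  constructor
  · intro hx
    exact ha.trans (Eq.symm hx)
  · intro hx
    exact hx.symm.trans ha

/-- Two realizations of the same type: what holds for the one holds for the other. -/
theorem CompactOver.exists_rel (h : CompactOver L A) {p : TypeOver L A 1} {a a' : C}
    (ha : a ∈ locus p) (ha' : a' ∈ locus p) (c : C) :
    ∃ c', tp L A ![c, a] = tp L A ![c', a'] :=
  h.exists_extension ((mem_locus_iff ha).1 ha') c

theorem tp_fst {a b a' b' : C} (h : tp L A ![a, b] = tp L A ![a', b']) :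
    tp L A ![a] = tp L A ![a'] := by
  have := tp_eq_comp h ![0]
  convert this using 2 <;> ext i <;> fin_cases i <;> rfl

theorem tp_swap {a b a' b' : C} (h : tp L A ![a, b] = tp L A ![a', b']) :
    tp L A ![b, a] = tp L A ![b', a'] := by
  have := tp_eq_comp h ![1, 0]
  convert this using 2 <;> ext i <;> fin_cases i <;> rfl

theorem locus_subset_of_mem {p : TypeOver L A 1} {X : Set C} (hX : A.Definable₁ L X) {a : C}
    (ha : a ∈ locus p) (haX : a ∈ X) : locus p ⊆ X := fun _ hx =>
  (tp_eq_mem hX ((mem_locus_iff ha).1 hx)).1 haX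

/-- If every `A`-definable set around `p(C)` left `X`, compactness would give a realization of `p`
outside `X`. This replaces `p(C)`, which need not be definable, by a definable set that can be
quantified over in formulas over `A`. -/
theorem CompactOver.exists_neighborhood (h : CompactOver L A) (p : TypeOver L A 1) {X : Set C}
    (hX : (univ : Set C).Definable₁ L X) (hp : locus p ⊆ X) :
    ∃ U : Set C, A.Definable₁ L U ∧ locus p ⊆ U ∧ U ⊆ X := by
  rcases (locus p).eq_empty_or_nonempty with h0 | ⟨a, ha⟩
  · exact ⟨∅, definable_empty, h0.subset, empty_subset _⟩
  by_contra! hU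
  obtain ⟨E, hE, hXE⟩ := exists_finite_parameters hX
  obtain ⟨y, hy⟩ := h E hE {Y | ∃ U : Set C, A.Definable₁ L U ∧ locus p ⊆ U ∧ Y = U ∩ Xᶜ}
    ⟨_, univ, definable_univ, subset_univ _, rfl⟩ (by
      rintro _ ⟨U, hd, -, rfl⟩
      exact (Set.Definable.mono hd subset_union_left).inter
        (Set.Definable.mono hXE subset_union_right).compl) (by
      rintro _ ⟨U, hd, h1, rfl⟩ _ ⟨U', hd', h1', rfl⟩
      exact ⟨U ∩ U', hd.inter hd', subset_inter h1 h1', by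
        ext; simp; tauto⟩) (by
      rintro _ ⟨U, hd, h1, rfl⟩
      obtain ⟨x, hx, hx'⟩ := Set.not_subset.1 (hU U hd h1)
      exact ⟨x, hx, hx'⟩)
  have hyp : y ∈ locus p := by
    rw [mem_locus_iff ha, tp_eq_one_iff]
    have key : ∀ U : Set C, A.Definable₁ L U → a ∈ U → y ∈ U := fun U hd haU =>
      (hy _ ⟨U, hd, locus_subset_of_mem hd ha haU, rfl⟩).1
    refine fun U hd => ⟨key U hd, fun hyU => ?_⟩
    by_contra haU
    exact key Uᶜ hd.compl haU hyU
  exact (hy _ ⟨univ, definable_univ, subset_univ _, rfl⟩).2 (hp hyp)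

end Compactness

/-! ### Sets containing an initial part -/

section Eventual

variable {C : Type w} {P : Set C} {lt : C → C → Prop} {D D' : Set C}

theorem LeftEventual.mono (h : LeftEventual P lt D) (hD : D ⊆ D') : LeftEventual P lt D' :=
  let ⟨a, ha, h⟩ := h
  ⟨a, ha, fun x hx hxa => hD (h x hx hxa)⟩

theorem LeftEventual.nonempty (h : LeftEventual P lt D) : ∃ x ∈ P, x ∈ D :=
  let ⟨a, ha, h⟩ := h
  ⟨a, ha, h a ha (.inr rfl)⟩

end Eventual

variable {L : FirstOrder.Language.{u, v}} {C : Type w} [L.Structure C] [Nonempty C] {A : Set C}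

/-! ### Reversing stationarily ordered pairs -/

/-- The reversed order. -/
def DefLinOrder.rev (O : DefLinOrder L A) : DefLinOrder L A where
  dom := O.dom
  lt x y := O.lt y x
  dom_definable := O.dom_definable
  lt_definable := definable_rel O.lt_definable subset_rfl (.proj L) (.proj L)
  lt_dom x y h := (O.lt_dom y x h).symm
  irrefl := O.irrefl
  trans x y z h h' := O.trans z y x h' h
  total x hx y hy := by
    rcases O.total x hx y hy with h | h | h
    exacts [.inr (.inr h), .inr (.inl h), .inl h]

namespace SOPair

/-- The pair with the reversed order. -/
def rev (p : SOPair L A) : SOPair L A where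
  type := p.type
  ord := p.ord.rev
  locus_subset := p.locus_subset
  left := p.right
  right := p.left

variable (p q : SOPair L A)

/-- The relation `x ≤ y` on the domain of the order of `p`. -/
def le (x y : C) : Prop := p.ord.lt x y ∨ x = y

variable {p q}

theorem lt_trans {x y z : C} (h : p.ord.lt x y) (h' : p.ord.lt y z) : p.ord.lt x z :=
  p.ord.trans _ _ _ h h'

theorem lt_of_le_of_lt {x y z : C} (h : p.le x y) (h' : p.ord.lt y z) : p.ord.lt x z := by
  rcases h with h | rfl
  exacts [lt_trans h h', h']

theorem lt_of_lt_of_le {x y z : C} (h : p.ord.lt x y) (h' : p.le y z) : p.ord.lt x z := by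
  rcases h' with h' | rfl
  exacts [lt_trans h h', h]

theorem le_trans {x y z : C} (h : p.le x y) (h' : p.le y z) : p.le x z := by
  rcases h with h | rfl
  exacts [.inl (lt_of_lt_of_le h h'), h']

theorem lt_or_le {x y : C} (hx : x ∈ p.ord.dom) (hy : y ∈ p.ord.dom) : p.ord.lt x y ∨ p.le y x := by
  rcases p.ord.total x hx y hy with h | h | h
  exacts [.inl h, .inr (.inr h.symm), .inr (.inl h)]

theorem not_lt_of_le {x y : C} (h : p.le x y) : ¬ p.ord.lt y x :=
  fun h' => p.ord.irrefl _ (lt_of_le_of_lt h h')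

theorem rev_le {x y : C} : p.rev.le x y ↔ p.le y x :=
  or_congr Iff.rfl eq_comm

theorem exists_le_le {x y : C} (hx : x ∈ locus p.type) (hy : y ∈ locus p.type) :
    ∃ z ∈ locus p.type, p.le z x ∧ p.le z y := by
  rcases lt_or_le (p.locus_subset hx) (p.locus_subset hy) with h | h
  exacts [⟨x, hx, .inr rfl, .inl h⟩, ⟨y, hy, h, .inr rfl⟩]

theorem le_definable : A.Definable₂ L {z : C × C | p.le z.1 z.2} :=
  definable_le p.ord.lt_definable subset_rfl (.proj L) (.proj L)

/-! ### The global type at the left end -/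

variable (p) in
/-- The global type of `p` at the left end contains the set `D`. -/
def Left (D : Set C) : Prop := LeftEventual (locus p.type) p.ord.lt D

theorem left_iff {D : Set C} :
    p.Left D ↔ ∃ a ∈ locus p.type, ∀ x ∈ locus p.type, p.le x a → x ∈ D := Iff.rfl

theorem rev_left_iff {D : Set C} :
    p.rev.Left D ↔ ∃ a ∈ locus p.type, ∀ x ∈ locus p.type, p.le a x → x ∈ D := by
  simp only [left_iff, rev_le]
  exact Iff.rfl

variable (p) in
theorem locus_nonempty : (locus p.type).Nonempty := by
  rcases p.left univ definable_univ with h | h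
  exacts [⟨_, h.nonempty.choose_spec.1⟩, ⟨_, h.nonempty.choose_spec.1⟩]

theorem Left.inter {D D' : Set C} (h : p.Left D) (h' : p.Left D') : p.Left (D ∩ D') := by
  obtain ⟨a, ha, h⟩ := left_iff.1 h
  obtain ⟨a', ha', h'⟩ := left_iff.1 h'
  obtain ⟨b, hb, hba, hba'⟩ := exists_le_le ha ha'
  exact left_iff.2 ⟨b, hb, fun x hx hxb => ⟨h x hx (le_trans hxb hba), h' x hx (le_trans hxb hba')⟩⟩

theorem Left.mono {D D' : Set C} (h : p.Left D) (hD : D ⊆ D') : p.Left D' :=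
  LeftEventual.mono h hD

theorem Left.nonempty {D : Set C} (h : p.Left D) : ∃ x ∈ locus p.type, x ∈ D :=
  LeftEventual.nonempty h

theorem not_left_iff {D : Set C} (hD : (univ : Set C).Definable₁ L D) :
    ¬ p.Left D ↔ p.Left Dᶜ := by
  refine ⟨(p.left D hD).resolve_left, fun h h' => ?_⟩
  obtain ⟨x, -, hx⟩ := (h.inter h').nonempty
  exact hx.1 hx.2

theorem left_of_locus_subset {D : Set C} (hD : locus p.type ⊆ D) : p.Left D := by
  obtain ⟨a, ha⟩ := p.locus_nonempty
  exact left_iff.2 ⟨a, ha, fun x hx _ => hD hx⟩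

theorem mem_below_iff {b x : C} : x ∈ p.below b ↔
    ∀ R : C → C → Prop, A.Definable₂ L {z : C × C | R z.1 z.2} → p.Left {x | R b x} → R b x := by
  constructor
  · intro h R hR hl
    exact h {x | R b x} (definable_rel hR (subset_insert _ _)
      (L.definableFun_const _ (mem_insert _ _)) (.proj L)) hl
  · intro h X hX hl
    obtain ⟨R, hR, rfl⟩ := exists_rel_slice hX
    exact h R hR hl

theorem below_subset_locus {b : C} : p.below b ⊆ locus p.type := by
  intro x hx
  obtain ⟨a, ha⟩ := p.locus_nonempty
  rw [mem_locus_iff ha, tp_eq_one_iff]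
  have key : ∀ X : Set C, A.Definable₁ L X → a ∈ X → x ∈ X := fun X hX haX =>
    hx X (Set.Definable.mono hX (subset_insert _ _))
      (left_of_locus_subset (locus_subset_of_mem hX ha haX))
  refine fun X hX => ⟨key X hX, fun hxX => ?_⟩
  by_contra haX
  exact key Xᶜ hX.compl haX hxX

/-- Definable sets that contain an initial part contain all elements of a definable neighbourhood
of the type below some realization. -/
theorem Left.exists_neighborhood (hc : CompactOver L A) {D : Set C}
    (hD : (univ : Set C).Definable₁ L D) (h : p.Left D) :
    ∃ a ∈ locus p.type, ∃ U : Set C, A.Definable₁ L U ∧ locus p.type ⊆ U ∧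
      ∀ x ∈ U, p.le x a → x ∈ D := by
  obtain ⟨a, ha, h⟩ := left_iff.1 h
  obtain ⟨U, hU, hpU, hUX⟩ := hc.exists_neighborhood p.type (X := {x | p.le x a → x ∈ D})
    (definable_imp (definable_rel le_definable (subset_univ _) (.proj L)
      (L.definableFun_const _ trivial)) hD) h
  exact ⟨a, ha, U, hU, hpU, hUX⟩

/-- The type at the left end is invariant. -/
theorem Left.congr (hc : CompactOver L A) {n : ℕ} {e e' : Fin n → C} (he : tp L A e = tp L A e')
    {D : Set (Fin (n + 1) → C)} (hD : A.Definable L D)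
    (h : p.Left {x | (Fin.cons x e : Fin (n + 1) → C) ∈ D}) :
    p.Left {x | (Fin.cons x e' : Fin (n + 1) → C) ∈ D} := by
  obtain ⟨a, ha, U, hU, hpU, h⟩ := h.exists_neighborhood hc
    (definable_slice hD (subset_univ _) fun _ => trivial)
  obtain ⟨a', ha'⟩ := hc.exists_extension he a
  -- With `U` in place of `p(C)`, the statement that `a` bounds an initial part contained in the set
  -- becomes a formula over `A` in `a` and `e`.
  have hdef : A.Definable L {v : Fin (n + 1) → C | ∀ x, x ∈ U → p.le x (v 0) →
      (Fin.cons x (Fin.tail v) : Fin (n + 1) → C) ∈ D} := by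
    refine definable_forall (definable_imp (definable_mem hU subset_rfl (.proj L))
      (definable_imp (definable_rel le_definable subset_rfl (.proj L) (.proj L)) ?_))
    refine hD.preimage_map (F := fun w : Fin (n + 1) ⊕ Unit → C =>
      (Fin.cons (w (.inr ())) (fun i : Fin n => w (.inl i.succ)) : Fin (n + 1) → C)) ?_
    intro i
    refine Fin.cases ?_ (fun i => ?_) i
    · exact .proj L
    · exact .proj L
  have h' := (tp_eq_iff.1 ha' _ hdef).1 (fun x hx hxa => by simpa using h x hx hxa)
  refine left_iff.2 ⟨a', ?_, fun x hx hxa => by simpa using h' x (hpU hx) hxa⟩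
  rw [mem_locus_iff ha]
  have := tp_eq_comp ha' ![0]
  convert this using 2 <;> ext i <;> fin_cases i <;> rfl

theorem Left.congr_rel (hc : CompactOver L A) {a a' : C} (ha : tp L A ![a] = tp L A ![a'])
    {R : C → C → Prop} (hR : A.Definable₂ L {z : C × C | R z.1 z.2})
    (h : p.Left {x | R x a}) : p.Left {x | R x a'} :=
  Left.congr hc ha (D := {v : Fin 2 → C | R (v 0) (v 1)}) hR h

/-! ### Forking dependence and the types at the ends -/

/-- By invariance, all instances along the sequence hold at the left end together with one of them.
Finitely many then share an initial part, against `k`-inconsistency. -/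
theorem not_left_of_divides (hc : CompactOver L A) {Y : Set C} (hY : Divides L A Y) :
    ¬ p.Left Y := by
  rintro h
  obtain ⟨n, φ, b, rfl, s, hs, k, hk⟩ := hY
  have hi : ∀ i, p.Left {x | φ.Realize (Fin.cons x (s i) : Fin (n + 1) → C)} := fun i =>
    Left.congr hc (hs i).symm ⟨φ, rfl⟩ h
  have hI : ∀ I : Finset ℕ,
      p.Left {x | ∀ i ∈ I, φ.Realize (Fin.cons x (s i) : Fin (n + 1) → C)} := by
    intro I
    induction I using Finset.induction_on with
    | empty => exact left_of_locus_subset fun _ _ => by simp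
    | insert i I _ ih =>
      refine ((hi i).inter ih).mono fun x hx => ?_
      simp only [Finset.mem_insert, forall_eq_or_imp, Set.mem_ofPred_eq]
      exact hx
  obtain ⟨x, -, hx⟩ := (hI (Finset.range k)).nonempty
  exact hk _ (Finset.card_range k) ⟨x, hx⟩

theorem Divides.definable {Y : Set C} (hY : Divides L A Y) : (univ : Set C).Definable₁ L Y := by
  obtain ⟨n, φ, b, rfl, -⟩ := hY
  exact definable_slice (A := A) (D := {v | φ.Realize v}) ⟨φ, rfl⟩ (subset_univ _) fun _ => trivial

theorem not_left_of_forks (hc : CompactOver L A) {X : Set C} (hX : Forks L A X) :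
    ¬ p.Left X := by
  rintro h
  obtain ⟨F, hF, hd, hXF⟩ := hX
  have hI : p.Left (⋃₀ F)ᶜ := by
    clear hXF h
    induction F, hF using Set.Finite.induction_on with
    | empty => exact left_of_locus_subset fun _ _ => by simp
    | @insert Y F _ _ ih =>
      have hY := hd Y (mem_insert _ _)
      have := (not_left_iff (p := p) (Divides.definable hY)).1 (not_left_of_divides hc hY)
      refine (this.inter (ih fun Z hZ => hd Z (mem_insert_of_mem _ hZ))).mono ?_
      rw [sUnion_insert, compl_union]
  obtain ⟨x, -, hx⟩ := (h.inter hI).nonempty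
  exact hx.2 (hXF hx.1)

/-- By compactness a forking formula implied by `tp(x/Ac)` is implied by a single formula of that
type, and this formula belongs to the left end type. -/
theorem not_dep_of_mem_below (hc : CompactOver L A) {x c : C} (hx : x ∈ p.below c) :
    ¬ Dep L A x c := by
  rintro ⟨X, hX, hxX, hfX⟩
  obtain ⟨U, hU, hxU, hUX⟩ := (hc.insert c).exists_neighborhood _ hX hxX
  refine not_left_of_forks (p := p) hc hfX (Left.mono ?_ hUX)
  by_contra hl
  have := (not_left_iff (p := p) (Set.Definable.mono hU (subset_univ _))).1 hl
  exact hx Uᶜ (Set.Definable.compl hU) this (hxU rfl)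

/-- An instance of a definable family that lies between two realizations of a stationarily
ordered type divides. -/
theorem divides_of_bounded (hc : CompactOver L A) {Q : C → C → Prop}
    (hQ : A.Definable₂ L {z : C × C | Q z.1 z.2}) {c a₁ a₂ : C} (h₁ : a₁ ∈ locus p.type)
    (h₂ : a₂ ∈ locus p.type) (h₁₂ : p.ord.lt a₁ a₂)
    (h : ∀ x, Q c x → p.ord.lt a₁ x ∧ p.ord.lt x a₂) :
    Divides L A {x | Q c x} := by
  -- Homogeneity copies the configuration `a₁`, `c`, `a₂` so that it starts at any `l`; the right
  -- bound of one copy then serves as the left bound of the next.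
  have step : ∀ l : locus p.type, ∃ (r : locus p.type) (c' : C),
      tp L A ![c'] = tp L A ![c] ∧ p.ord.lt l r ∧
        ∀ x, Q c' x → p.ord.lt l x ∧ p.ord.lt x r := by
    rintro ⟨l, hl⟩
    obtain ⟨c', hc'⟩ := hc.exists_rel h₁ hl c
    obtain ⟨r, hr⟩ := hc.exists_extension hc' a₂
    have hr' : tp L A ![a₂] = tp L A ![r] := by
      have := tp_eq_comp hr ![0]
      convert this using 2 <;> ext i <;> fin_cases i <;> rfl
    refine ⟨⟨r, (mem_locus_iff h₂).2 hr'⟩, c', (tp_fst hc').symm, ?_⟩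
    have hdef : A.Definable L {v : Fin 3 → C | p.ord.lt (v 2) (v 0) ∧
        ∀ x, Q (v 1) x → p.ord.lt (v 2) x ∧ p.ord.lt x (v 0)} :=
      definable_and (definable_rel p.ord.lt_definable subset_rfl (.proj L) (.proj L)) <|
      definable_forall (definable_imp (definable_rel hQ subset_rfl (.proj L) (.proj L))
        (definable_and (definable_rel p.ord.lt_definable subset_rfl (.proj L) (.proj L))
          (definable_rel p.ord.lt_definable subset_rfl (.proj L) (.proj L))))
    exact (tp_eq_iff.1 hr _ hdef).1 ⟨h₁₂, h⟩
  choose r c' htp hlt hlr using step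
  let s : ℕ → locus p.type := fun n => Nat.rec ⟨a₁, h₁⟩ (fun _ => r) n
  have hle : ∀ i j, p.le (s (i + 1)).1 (s (i + 1 + j)).1 := by
    intro i j
    induction j with
    | zero => exact .inr rfl
    | succ j ih => exact le_trans ih (.inl (hlt _))
  have hdisj : ∀ i j, i < j → ∀ x, Q (c' (s i)) x → ¬ Q (c' (s j)) x := by
    intro i j hij x hi hj
    obtain ⟨k, rfl⟩ := Nat.exists_eq_add_of_le (Nat.succ_le_of_lt hij)
    exact not_lt_of_le (hle i k) (lt_trans (hlr _ x hj).1 (hlr _ x hi).2)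
  obtain ⟨φ, hφ⟩ : A.Definable L {v : Fin 2 → C | Q (v 1) (v 0)} :=
    definable_rel hQ subset_rfl (.proj L) (.proj L)
  have hφ' : ∀ x d, φ.Realize (Fin.cons x ![d] : Fin 2 → C) ↔ Q d x := fun x d =>
    (Set.ext_iff.1 hφ ![x, d]).symm
  refine ⟨1, φ, ![c], ?_, fun i => ![c' (s i)], fun i => htp _, 2, ?_⟩
  · ext x
    exact (hφ' x c).symm
  · rintro I hI ⟨x, hx⟩
    obtain ⟨i, j, hij, rfl⟩ := Finset.card_eq_two.1 hI
    have hi := (hφ' _ _).1 (hx i (by simp))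
    have hj := (hφ' _ _).1 (hx j (by simp))
    rcases lt_or_gt_of_ne hij with h | h
    exacts [hdisj _ _ h x hi hj, hdisj _ _ h x hj hi]

/-- A realization of `p` depends on `c` if and only if it realizes over `c` neither of the types
at the ends. -/
theorem dep_iff (hc : CompactOver L A) {x : C} (hx : x ∈ locus p.type) (c : C) :
    Dep L A x c ↔ x ∉ p.below c ∧ x ∉ p.rev.below c := by
  refine ⟨fun h => ⟨fun h' => not_dep_of_mem_below hc h' h,
    fun h' => not_dep_of_mem_below hc h' h⟩, ?_⟩
  rintro ⟨h₁, h₂⟩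
  rw [mem_below_iff] at h₁ h₂
  push Not at h₁ h₂
  obtain ⟨R₁, hR₁, hl₁, hx₁⟩ := h₁
  obtain ⟨R₂, hR₂, hl₂, hx₂⟩ := h₂
  obtain ⟨a₁, ha₁, U₁, hU₁, hpU₁, h₁⟩ := hl₁.exists_neighborhood hc (rel_definable hR₁ c)
  obtain ⟨a₂, ha₂, U₂, hU₂, hpU₂, h₂⟩ := hl₂.exists_neighborhood hc (rel_definable hR₂ c)
  simp only [rev_le] at h₂
  -- Failing both `R₁` and `R₂` keeps a point away from the two ends; `U₁` and `U₂` make this valid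
  -- for all points of the set, not only for realizations of `p`.
  let Q : C → C → Prop := fun c x =>
    (¬ R₁ c x ∧ ¬ R₂ c x) ∧ (x ∈ U₁ ∧ x ∈ U₂) ∧ x ∈ p.ord.dom
  have hQ : A.Definable₂ L {z : C × C | Q z.1 z.2} :=
    definable_and (definable_and
      (definable_not (definable_rel hR₁ subset_rfl (.proj L) (.proj L)))
      (definable_not (definable_rel hR₂ subset_rfl (.proj L) (.proj L)))) <|
    definable_and (definable_and (definable_mem hU₁ subset_rfl (.proj L))
      (definable_mem hU₂ subset_rfl (.proj L)))
      (definable_mem p.ord.dom_definable subset_rfl (.proj L))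
  have hQx : Q c x := ⟨⟨hx₁, hx₂⟩, ⟨hpU₁ hx, hpU₂ hx⟩, p.locus_subset hx⟩
  have hb : ∀ y, Q c y → p.ord.lt a₁ y ∧ p.ord.lt y a₂ := by
    rintro y ⟨⟨hy₁, hy₂⟩, ⟨hyU₁, hyU₂⟩, hy⟩
    exact ⟨(lt_or_le (p.locus_subset ha₁) hy).resolve_right fun h => hy₁ (h₁ y hyU₁ h),
      (lt_or_le hy (p.locus_subset ha₂)).resolve_right fun h => hy₂ (h₂ y hyU₂ h)⟩
  have hd := divides_of_bounded hc hQ ha₁ ha₂ (lt_trans (hb x hQx).1 (hb x hQx).2) hb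
  refine ⟨{y | Q c y}, rel_definable hQ c, ?_, {{y | Q c y}}, finite_singleton _, ?_, ?_⟩
  · refine locus_subset_of_mem (definable_rel hQ (subset_insert _ _)
      (L.definableFun_const _ (mem_insert _ _)) (.proj L)) (a := x) rfl hQx
  · rintro _ rfl
    exact hd
  · simp

end SOPair

theorem CompactOver.transfer (hc : CompactOver L A) {P Q : TypeOver L A 1} {R : C → C → Prop}
    (hR : A.Definable₂ L {z : C × C | R z.1 z.2}) {a a' x : C} (ha : a ∈ locus P)
    (hx : x ∈ locus Q) (h : R a x) (ha' : a' ∈ locus P) : ∃ x' ∈ locus Q, R a' x' := by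
  obtain ⟨x', hx'⟩ := hc.exists_rel ha ha' x
  exact ⟨x', (mem_locus_iff hx).2 (tp_fst hx'), (tp_eq_rel hR (tp_swap hx')).1 h⟩

namespace SOPair

/-! ### Definable families of initial parts -/

/-- A definable family of initial parts of the order of `q`, each of which cuts `q(C)` properly
if the index realizes `p`. -/
structure Fam (p q : SOPair L A) (R : C → C → Prop) : Prop where
  definable : A.Definable₂ L {z : C × C | R z.1 z.2}
  down : ∀ a x y, q.ord.lt y x → R a x → R a y
  nonempty : ∀ a ∈ locus p.type, ∃ x ∈ locus q.type, R a x
  bounded : ∀ a ∈ locus p.type, ∃ x ∈ locus q.type, ¬ R a x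

/-- A family of initial parts that increases with the index. -/
structure MonoFam (p q : SOPair L A) (R : C → C → Prop) : Prop extends Fam p q R where
  mono : ∀ a a' x, p.ord.lt a a' → R a x → R a' x

/-- A family whose members contain a given realization of `q` for large indices and omit it for
small ones. -/
def Increasing (p q : SOPair L A) (R : C → C → Prop) : Prop :=
  ∀ e ∈ locus q.type, p.Left {z | ¬ R z e} ∧ p.rev.Left {z | R z e}

variable {p q r : SOPair L A} {R R' : C → C → Prop}

theorem Fam.of_le (h : Fam p q R) {a x y : C} (hx : R a x) (hyx : q.le y x) : R a y := by
  rcases hyx with hyx | rfl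
  exacts [h.down _ _ _ hyx hx, hx]

theorem Fam.lt_of_mem (h : Fam p q R) {a x y : C} (hx : R a x) (hy : ¬ R a y)
    (hdx : x ∈ q.ord.dom) (hdy : y ∈ q.ord.dom) : q.ord.lt x y :=
  (lt_or_le hdx hdy).resolve_right fun hle => hy (h.of_le hx hle)

theorem MonoFam.of_le_index (h : MonoFam p q R) {a a' x : C} (haa : p.le a a') (hx : R a x) :
    R a' x := by
  rcases haa with haa | rfl
  exacts [h.mono _ _ _ haa hx, hx]

theorem Fam.compl (h : Fam p q R) : Fam p.rev q.rev fun a x => ¬ R a x where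
  definable := definable₂_not h.definable
  down _ _ _ hlt hx hy := hx (h.down _ _ _ hlt hy)
  nonempty := h.bounded
  bounded a ha := by
    obtain ⟨x, hx, hR⟩ := h.nonempty a ha
    exact ⟨x, hx, not_not.2 hR⟩

theorem MonoFam.compl (h : MonoFam p q R) : MonoFam p.rev q.rev fun a x => ¬ R a x where
  toFam := h.toFam.compl
  mono _ _ _ hlt hx hy := hx (h.mono _ _ _ hlt hy)

theorem MonoFam.dual (hc : CompactOver L A) (h : MonoFam p q R) :
    MonoFam q p fun b a => ¬ R a b where
  definable := definable₂_not (R := fun b a => R a b) (definable₂_swap h.definable)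
  down _ _ _ hlt hx hy := hx (h.mono _ _ _ hlt hy)
  nonempty b hb := by
    obtain ⟨a, ha⟩ := p.locus_nonempty
    obtain ⟨x, hx, hR⟩ := h.bounded a ha
    exact hc.transfer (R := fun b a => ¬ R a b)
      (definable₂_not (R := fun b a => R a b) (definable₂_swap h.definable)) hx ha hR hb
  bounded b hb := by
    obtain ⟨a, ha⟩ := p.locus_nonempty
    obtain ⟨x, hx, hR⟩ := h.nonempty a ha
    obtain ⟨a', ha', hR'⟩ :=
      hc.transfer (R := fun b a => R a b) (definable₂_swap h.definable) hx ha hR hb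
    exact ⟨a', ha', not_not.2 hR'⟩
  mono _ _ _ hlt hx hy := hx (h.down _ _ _ hlt hy)

/-- A family cannot contain a realization of `q` both for small and for large indices. -/
theorem Fam.not_left_and_right (hc : CompactOver L A) (h : Fam p q R) {d : C}
    (hd : d ∈ locus q.type) (hl : p.Left {z | R z d}) (hr : p.rev.Left {z | R z d}) : False := by
  obtain ⟨a, ha, had⟩ : ∃ a ∈ locus p.type, ¬ R a d := by
    obtain ⟨a, ha⟩ := p.locus_nonempty
    obtain ⟨x, hx, hR⟩ := h.bounded a ha
    exact hc.transfer (R := fun b a => ¬ R a b)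
      (definable₂_not (R := fun b a => R a b) (definable₂_swap h.definable)) hx ha hR hd
  obtain ⟨z₀, hz₀, U₀, hU₀, hpU₀, h₀⟩ := hl.exists_neighborhood hc (rel_definable' h.definable d)
  obtain ⟨z₁, hz₁, U₁, hU₁, hpU₁, h₁⟩ := hr.exists_neighborhood hc (rel_definable' h.definable d)
  simp only [rev_le] at h₁
  -- `G y` is the common part of the members up to `y`, `G' y` that of the members from `y` on. Far
  -- to the left `d` lies in `G y` but not in `G' y`, far to the right it is the other way round.
  -- Both failures of inclusion are `A`-definable conditions on `y`, hence hold at `a` as well; but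
  -- `G a` and `G' a` are initial parts and so comparable.
  let G : C → C → Prop := fun y x => ∀ z, z ∈ U₀ → p.le z y → R z x
  let G' : C → C → Prop := fun y x => ∀ z, z ∈ U₁ → p.le y z → R z x
  have hG : A.Definable₂ L {z : C × C | G z.1 z.2} :=
    definable_forall <| definable_imp (definable_mem hU₀ subset_rfl (.proj L)) <|
      definable_imp (definable_rel le_definable subset_rfl (.proj L) (.proj L))
        (definable_rel h.definable subset_rfl (.proj L) (.proj L))
  have hG' : A.Definable₂ L {z : C × C | G' z.1 z.2} :=
    definable_forall <| definable_imp (definable_mem hU₁ subset_rfl (.proj L)) <|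
      definable_imp (definable_rel le_definable subset_rfl (.proj L) (.proj L))
        (definable_rel h.definable subset_rfl (.proj L) (.proj L))
  have hP : A.Definable₁ L {y | ∃ x, x ∈ q.ord.dom ∧ G y x ∧ ¬ G' y x} :=
    definable_exists <| definable_and (definable_mem q.ord.dom_definable subset_rfl (.proj L)) <|
      definable_and (definable_rel hG subset_rfl (.proj L) (.proj L))
        (definable_not (definable_rel hG' subset_rfl (.proj L) (.proj L)))
  have hP' : A.Definable₁ L {y | ∃ x, x ∈ q.ord.dom ∧ G' y x ∧ ¬ G y x} :=
    definable_exists <| definable_and (definable_mem q.ord.dom_definable subset_rfl (.proj L)) <|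
      definable_and (definable_rel hG' subset_rfl (.proj L) (.proj L))
        (definable_not (definable_rel hG subset_rfl (.proj L) (.proj L)))
  have hqd := q.locus_subset hd
  obtain ⟨y₀, hy₀, hyz₀, hya₀⟩ := exists_le_le hz₀ ha
  obtain ⟨y₁, hy₁, hyz₁, hya₁⟩ := exists_le_le (p := p.rev) hz₁ ha
  rw [rev_le] at hyz₁ hya₁
  obtain ⟨x, hx, hx1, hx2⟩ := locus_subset_of_mem hP hy₀ ⟨d, hqd,
    fun z hz hzy => h₀ z hz (le_trans hzy hyz₀), fun hn => had (hn a (hpU₁ ha) hya₀)⟩ ha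
  obtain ⟨x', hx', hx1', hx2'⟩ := locus_subset_of_mem hP' hy₁ ⟨d, hqd,
    fun z hz hzy => h₁ z hz (le_trans hyz₁ hzy), fun hn => had (hn a (hpU₀ ha) hya₁)⟩ ha
  rcases lt_or_le hx hx' with hlt | hle
  · exact hx2 fun z hz hza => h.down _ _ _ hlt (hx1' z hz hza)
  · exact hx2' fun z hz hza => h.of_le (hx1 z hz hza) hle

theorem Increasing.compl (h : Increasing p q R) :
    Increasing p.rev q.rev fun a x => ¬ R a x := fun e he =>
  ⟨by simpa only [not_not] using (h e he).2, (h e he).1⟩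

/-- Membership of `e` has a limit value at each end of `p(C)`. Equal limits are excluded by
`Fam.not_left_and_right`, applied to the family or to its complement. -/
theorem Fam.increasing_or (hc : CompactOver L A) (h : Fam p q R) :
    Increasing p q R ∨ Increasing p.rev q R := by
  obtain ⟨e, he⟩ := q.locus_nonempty
  have key : ∀ e' ∈ locus q.type, tp L A ![e] = tp L A ![e'] := fun e' he' =>
    (mem_locus_iff he).1 he'
  have hd := rel_definable' h.definable e
  have hn := definable₂_not h.definable
  rcases p.left _ hd with h₁ | h₁ <;> rcases p.right _ hd with h₂ | h₂
  · exact (h.not_left_and_right hc he h₁ h₂).elim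
  · exact .inr fun e' he' => ⟨Left.congr_rel (p := p.rev) hc (key e' he') (R := fun z e => ¬ R z e) hn h₂,
      Left.congr_rel (p := p) hc (key e' he') h.definable h₁⟩
  · exact .inl fun e' he' => ⟨Left.congr_rel (p := p) hc (key e' he') (R := fun z e => ¬ R z e) hn h₁,
      Left.congr_rel (p := p.rev) hc (key e' he') h.definable h₂⟩
  · exact (h.compl.not_left_and_right hc he h₂ h₁).elim

theorem Fam.union (h : Fam p q R) (h' : Fam p q R') : Fam p q fun a x => R a x ∨ R' a x where
  definable := definable_or h.definable h'.definable
  down _ _ _ hlt := Or.imp (h.down _ _ _ hlt) (h'.down _ _ _ hlt)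
  nonempty a ha := by
    obtain ⟨x, hx, hR⟩ := h.nonempty a ha
    exact ⟨x, hx, .inl hR⟩
  bounded a ha := by
    obtain ⟨x, hx, hR⟩ := h.bounded a ha
    obtain ⟨x', hx', hR'⟩ := h'.bounded a ha
    obtain ⟨y, hy, hyx, hyx'⟩ := exists_le_le (p := q.rev) hx hx'
    rw [rev_le] at hyx hyx'
    exact ⟨y, hy, fun h'' => h''.elim (fun h'' => hR (h.of_le h'' hyx))
      fun h'' => hR' (h'.of_le h'' hyx')⟩

/-- If the directions were opposite, the union of the two families would contain `e` at both ends.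
-/
theorem Increasing.of_increasing (hc : CompactOver L A) (hi : Increasing p q R) (h : Fam p q R)
    (h' : Fam p q R') : Increasing p q R' := by
  refine (h'.increasing_or hc).resolve_right fun hi' => ?_
  obtain ⟨e, he⟩ := q.locus_nonempty
  exact (h.union h').not_left_and_right hc he ((hi' e he).2.mono fun _ => .inr)
    ((hi e he).2.mono fun _ => .inl)

theorem MonoFam.increasing (hc : CompactOver L A) (h : MonoFam p q R) : Increasing p q R := by
  intro e he
  obtain ⟨a, ha, hR⟩ := (h.dual hc).nonempty e he
  obtain ⟨a', ha', hR'⟩ := (h.dual hc).bounded e he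
  refine ⟨left_iff.2 ⟨a, ha, fun x _ hxa hx => hR (h.of_le_index hxa hx)⟩,
    rev_left_iff.2 ⟨a', ha', fun x _ hxa => h.of_le_index hxa (not_not.1 hR')⟩⟩

/-- The union of the members at indices up to `z` is monotone in `z`. It stays bounded because an
increasing family omits `e` at all small indices. -/
theorem Fam.exists_mono_ge (hc : CompactOver L A) (h : Fam p q R) (hi : Increasing p q R) :
    ∃ R', MonoFam p q R' ∧ ∀ z ∈ locus p.type, ∀ x, R z x → R' z x := by
  obtain ⟨e, he⟩ := q.locus_nonempty
  obtain ⟨a, ha, U, hU, hpU, hUR⟩ := (hi e he).1.exists_neighborhood hc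
    (rel_definable' (R := fun z e => ¬ R z e) (definable₂_not h.definable) e)
  have hle : ∀ z ∈ locus p.type, ∀ x, R z x → ∃ z', z' ∈ U ∧ p.le z' z ∧ R z' x :=
    fun z hz x hx => ⟨z, hpU hz, .inr rfl, hx⟩
  have hdef : A.Definable₂ L {v : C × C | ∃ z', z' ∈ U ∧ p.le z' v.1 ∧ R z' v.2} :=
    definable_exists <| definable_and (definable_mem hU subset_rfl (.proj L)) <|
      definable_and (definable_rel le_definable subset_rfl (.proj L) (.proj L))
        (definable_rel h.definable subset_rfl (.proj L) (.proj L))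
  refine ⟨fun z x => ∃ z', z' ∈ U ∧ p.le z' z ∧ R z' x, ⟨⟨hdef, ?_, ?_, ?_⟩, ?_⟩, hle⟩
  · rintro z x y hyx ⟨z', hz', hzz, hR⟩
    exact ⟨z', hz', hzz, h.down _ _ _ hyx hR⟩
  · intro z hz
    obtain ⟨x, hx, hR⟩ := h.nonempty z hz
    exact ⟨x, hx, hle z hz x hR⟩
  · intro z hz
    refine hc.transfer (R := fun z x => ¬ ∃ z', z' ∈ U ∧ p.le z' z ∧ R z' x)
      (Set.Definable.compl hdef) ha he ?_ hz
    rintro ⟨z', hz', hza, hR⟩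
    exact hUR z' hz' hza hR
  · rintro z z₂ x hlt ⟨z', hz', hzz, hR⟩
    exact ⟨z', hz', le_trans hzz (.inl hlt), hR⟩

theorem Fam.exists_mono_le (hc : CompactOver L A) (h : Fam p q R) (hi : Increasing p q R) :
    ∃ R', MonoFam p q R' ∧ ∀ z ∈ locus p.type, ∀ x, R' z x → R z x := by
  obtain ⟨S, hS, hRS⟩ := h.compl.exists_mono_ge hc hi.compl
  exact ⟨_, hS.compl, fun z hz x hx => by_contra fun hR => hx (hRS z hz x hR)⟩

/-- A formula over `a` in the left end type that misses `b` is shrunk to an initial part. At `a` it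
is non-empty because of `d` and bounded because of `b`; homogeneity carries both to every index. -/
theorem exists_fam_of_notMem_below (hc : CompactOver L A) {a b : C} (ha : a ∈ locus p.type)
    (hb : b ∈ locus q.type) (h : b ∉ q.below a) : ∃ R, Fam p q R ∧ ¬ R a b := by
  rw [mem_below_iff] at h
  push Not at h
  obtain ⟨R₀, hR₀, hl, hR₀b⟩ := h
  obtain ⟨d, hd, U, hU, hpU, hUR⟩ := hl.exists_neighborhood hc (rel_definable hR₀ a)
  have hdef : A.Definable₂ L {v : C × C | ∀ y, y ∈ U → q.le y v.2 → R₀ v.1 y} :=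
    definable_forall <| definable_imp (definable_mem hU subset_rfl (.proj L)) <|
      definable_imp (definable_rel le_definable subset_rfl (.proj L) (.proj L))
        (definable_rel hR₀ subset_rfl (.proj L) (.proj L))
  have hab : ¬ ∀ y, y ∈ U → q.le y b → R₀ a y := fun h => hR₀b (h b (hpU hb) (.inr rfl))
  exact ⟨fun a x => ∀ y, y ∈ U → q.le y x → R₀ a y,
    ⟨hdef, fun a x y hyx hx z hz hzy => hx z hz (le_trans hzy (.inl hyx)),
      fun z hz => hc.transfer (R := fun a x => ∀ y, y ∈ U → q.le y x → R₀ a y) hdef ha hd hUR hz,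
      fun z hz => hc.transfer (R := fun a x => ¬ ∀ y, y ∈ U → q.le y x → R₀ a y)
        (Set.Definable.compl hdef) ha hb hab hz⟩, hab⟩

theorem Fam.of_mem_below (h : Fam p q R) {a b : C} (ha : a ∈ locus p.type) (hb : b ∈ q.below a) :
    R a b := by
  rw [mem_below_iff] at hb
  obtain ⟨x, hx, hR⟩ := h.nonempty a ha
  exact hb R h.definable (left_iff.2 ⟨x, hx, fun y _ hyx => h.of_le hR hyx⟩)

/-! ### Linked pairs and the order on the realizations of their types -/

variable (p q) in
/-- There is an increasing family of initial parts of `q(C)` indexed by `p(C)`. -/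
def Linked : Prop := ∃ R, MonoFam p q R

theorem Linked.symm (hc : CompactOver L A) (h : Linked p q) : Linked q p :=
  let ⟨_, h⟩ := h
  ⟨_, h.dual hc⟩

theorem Linked.rev (h : Linked p q) : Linked p.rev q.rev :=
  let ⟨_, h⟩ := h
  ⟨_, h.compl⟩

theorem exists_lt_of_lt (hc : CompactOver L A) {x y z : C} (hx : x ∈ locus p.type)
    (hy : y ∈ locus p.type) (h : p.ord.lt x y) (hz : z ∈ locus p.type) :
    (∃ w ∈ locus p.type, p.ord.lt z w) ∧ ∃ w ∈ locus p.type, p.ord.lt w z :=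
  ⟨hc.transfer p.ord.lt_definable hx hy h hz,
    hc.transfer (R := fun x y => p.ord.lt y x) (definable₂_swap p.ord.lt_definable) hy hx h hz⟩

/-- The order itself is a monotone family once `q(C)` has no greatest element. A set that properly
cuts `q(C)` yields realizations `x < y`, and homogeneity does the rest. -/
theorem Linked.monoFam_le (hc : CompactOver L A) (h : Linked p q) :
    MonoFam q q fun b c => q.le c b := by
  obtain ⟨R, h⟩ := h
  obtain ⟨a, ha⟩ := p.locus_nonempty
  obtain ⟨x, hx, hR⟩ := h.nonempty a ha
  obtain ⟨y, hy, hR'⟩ := h.bounded a ha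
  have hxy := h.lt_of_mem hR hR' (q.locus_subset hx) (q.locus_subset hy)
  refine ⟨⟨definable₂_swap (R := q.le) le_definable,
    fun a x y hyx hx => le_trans (.inl hyx) hx, fun b hb => ⟨b, hb, .inr rfl⟩, fun b hb => ?_⟩,
    fun a a' x haa hx => le_trans hx (.inl haa)⟩
  obtain ⟨c, hc', hbc⟩ := (exists_lt_of_lt hc hx hy hxy hb).1
  exact ⟨c, hc', fun h => not_lt_of_le h hbc⟩

theorem Linked.self_right (hc : CompactOver L A) (h : Linked p q) : Linked q q :=
  ⟨_, h.monoFam_le hc⟩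

theorem Linked.self_left (hc : CompactOver L A) (h : Linked p q) : Linked p p :=
  (h.symm hc).self_right hc

theorem MonoFam.comp (h : MonoFam p q R) (h' : MonoFam q r R') :
    MonoFam p r fun a c => ∃ b, b ∈ q.ord.dom ∧ R a b ∧ R' b c where
  definable := definable_exists <|
    definable_and (definable_mem q.ord.dom_definable subset_rfl (.proj L)) <|
      definable_and (definable_rel h.definable subset_rfl (.proj L) (.proj L))
        (definable_rel h'.definable subset_rfl (.proj L) (.proj L))
  down := by
    rintro a x y hyx ⟨b, hb, hab, hbx⟩
    exact ⟨b, hb, hab, h'.down _ _ _ hyx hbx⟩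
  nonempty a ha := by
    obtain ⟨b, hb, hab⟩ := h.nonempty a ha
    obtain ⟨c, hc, hbc⟩ := h'.nonempty b hb
    exact ⟨c, hc, b, q.locus_subset hb, hab, hbc⟩
  bounded a ha := by
    obtain ⟨b, hb, hab⟩ := h.bounded a ha
    obtain ⟨c, hc, hbc⟩ := h'.bounded b hb
    refine ⟨c, hc, ?_⟩
    rintro ⟨b', hb', hab', hbc'⟩
    exact hbc (h'.mono _ _ _ (h.lt_of_mem hab' hab hb' (q.locus_subset hb)) hbc')
  mono := by
    rintro a a' x haa ⟨b, hb, hab, hbx⟩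
    exact ⟨b, hb, h.mono _ _ _ haa hab, hbx⟩

variable (p q) in
/-- The realization `a` of `p` lies below the realization `b` of `q` in every respect:
no increasing family of initial parts catches `b` at `a`. -/
def Prec (a b : C) : Prop := ∀ R, MonoFam p q R → ¬ R a b

variable {a b c : C}

/-- A family containing `b` at `a` composed with one containing `c` at `b` contains `c` at `a`. This
is negative transitivity, the defining property of a weak order. -/
theorem Prec.not_trans (h : ¬ Prec p q a b) (h' : ¬ Prec q r b c) (hb : b ∈ locus q.type) :
    ¬ Prec p r a c := by
  simp only [Prec, not_forall, not_not] at h h'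
  obtain ⟨R, hR, hab⟩ := h
  obtain ⟨R', hR', hbc⟩ := h'
  exact fun hac => hac _ (hR.comp hR') ⟨b, q.locus_subset hb, hab, hbc⟩

theorem Prec.asymm (hc : CompactOver L A) (hL : Linked p q) (h : Prec p q a b) :
    ¬ Prec q p b a := by
  obtain ⟨R, hR⟩ := hL
  exact fun h' => h' _ (hR.dual hc) (h R hR)

theorem Prec.trans (hc : CompactOver L A) (hL : Linked p q) (ha : a ∈ locus p.type)
    (h : Prec p q a b) (h' : Prec q r b c) : Prec p r a c :=
  by_contra fun hn => Prec.not_trans (h.asymm hc hL) hn ha h'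

theorem Prec.lt (hc : CompactOver L A) (hL : Linked p q) (ha : a ∈ locus q.type)
    (hb : b ∈ locus q.type) (h : Prec q q a b) : q.ord.lt a b :=
  (lt_or_le (q.locus_subset ha) (q.locus_subset hb)).resolve_right (h _ (hL.monoFam_le hc))

theorem prec_rev (hc : CompactOver L A) : Prec q.rev p.rev b a ↔ Prec p q a b :=
  ⟨fun h _ hR hab => h _ (hR.dual hc).compl (not_not.2 hab),
    fun h _ hR hab => h _ (hR.dual hc).compl (not_not.2 hab)⟩

/-- Dualizing turns families from `q` to `p` into families from `p` to `q`, whose members at `a`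
belong to the left end type. Conversely, a formula that excludes `b` gives a family; it has the
direction of the linking family and therefore shrinks to a monotone one. -/
theorem mem_below_iff_prec (hc : CompactOver L A) (hL : Linked p q) (ha : a ∈ locus p.type)
    (hb : b ∈ locus q.type) : b ∈ q.below a ↔ Prec q p b a := by
  constructor
  · intro h R hR hba
    exact (hR.dual hc).of_mem_below ha h hba
  · intro h
    by_contra hn
    obtain ⟨R, hR, hab⟩ := exists_fam_of_notMem_below hc ha hb hn
    obtain ⟨S, hS⟩ := hL
    obtain ⟨R', hR', hle⟩ := hR.exists_mono_le hc
      ((hS.increasing hc).of_increasing hc hS.toFam hR)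
    exact h _ (hR'.dual hc) fun h' => hab (hle a ha b h')

theorem mem_rev_below_iff_prec (hc : CompactOver L A) (hL : Linked p q) (ha : a ∈ locus p.type)
    (hb : b ∈ locus q.type) : b ∈ q.rev.below a ↔ Prec p q a b := by
  rw [mem_below_iff_prec (p := p.rev) hc hL.rev ha hb, prec_rev hc]

theorem dep_iff_prec (hc : CompactOver L A) (hL : Linked p q) (ha : a ∈ locus p.type)
    (hb : b ∈ locus q.type) : Dep L A b a ↔ ¬ Prec q p b a ∧ ¬ Prec p q a b := by
  rw [dep_iff (p := q) hc hb, mem_below_iff_prec hc hL ha hb, mem_rev_below_iff_prec hc hL ha hb]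

theorem exists_mem_below (hc : CompactOver L A) (a : C) : (q.below a).Nonempty := by
  obtain ⟨x, hx⟩ := hc {a} (finite_singleton a) {X | (insert a A).Definable₁ L X ∧ q.Left X}
    ⟨univ, definable_univ, left_of_locus_subset (subset_univ _)⟩
    (by rintro X ⟨hX, -⟩; rwa [Set.union_singleton])
    (fun X hX Y hY => ⟨Set.Definable.inter hX.1 hY.1, hX.2.inter hY.2⟩)
    (fun X hX => let ⟨x, _, hx⟩ := hX.2.nonempty; ⟨x, hx⟩)
  exact ⟨x, fun X hX hl => hx X ⟨hX, hl⟩⟩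

/-- Over `a`, all elements of `q.below a` have the same type. -/
theorem tp_eq_of_mem_below {b b' : C} (hb : b ∈ q.below a) (hb' : b' ∈ q.below a) :
    tp L A ![a, b] = tp L A ![a, b'] := by
  have key : ∀ b ∈ q.below a, ∀ b' ∈ q.below a, ∀ D : Set (Fin 2 → C), A.Definable L D →
      ![a, b] ∈ D → ![a, b'] ∈ D := by
    intro b hb b' hb' D hD h
    have hR : A.Definable₂ L {z : C × C | (![z.1, z.2] : Fin 2 → C) ∈ D} :=
      hD.preimage_map (F := fun v : Fin 2 → C => ![v 0, v 1]) (by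
        intro i; fin_cases i; exacts [.proj L, .proj L])
    rw [mem_below_iff] at hb hb'
    refine hb' (fun a x => ![a, x] ∈ D) hR ?_
    by_contra hl
    have := (not_left_iff (rel_definable (R := fun a x => ![a, x] ∈ D) hR a)).1 hl
    exact hb (fun a x => ¬ ![a, x] ∈ D) (Set.Definable.compl hR) this h
  exact tp_eq_iff.2 fun D hD => ⟨key b hb b' hb' D hD, key b' hb' b hb D hD⟩

/-- Otherwise all of `q(C)` realizes the left end type over every `a`; as this type is complete over
`Aa`, the types would be weakly orthogonal. -/
theorem DirectNonorth.exists_fam (hc : CompactOver L A) (h : p.DirectNonorth q) :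
    ∃ R, Fam p q R := by
  by_contra! hn
  have hall : ∀ a ∈ locus p.type, ∀ b ∈ locus q.type, b ∈ q.below a := by
    intro a ha b hb
    by_contra hb'
    obtain ⟨R, hR, -⟩ := exists_fam_of_notMem_below hc ha hb hb'
    exact hn R hR
  refine h.1 fun a ha a' ha' b hb b' hb' => ?_
  obtain ⟨c, hac⟩ := hc.exists_rel ha ha' b
  have hcq := (mem_locus_iff hb).2 (tp_fst hac)
  exact (tp_swap hac).trans (tp_eq_of_mem_below (hall a' ha' c hcq) (hall a' ha' b' hb'))

theorem DirectNonorth.linked (hc : CompactOver L A) (h : p.DirectNonorth q) : Linked p q := by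
  obtain ⟨R, hR⟩ := h.exists_fam hc
  rcases hR.increasing_or hc with hi | hi
  · obtain ⟨R', hR', -⟩ := hR.exists_mono_le hc hi
    exact ⟨R', hR'⟩
  -- A decreasing family omits `e` at every large `z`, while `δ(p, q)` keeps `e` in `q.below z` and
  -- hence in the member at `z`.
  · obtain ⟨a, ha⟩ := p.locus_nonempty
    obtain ⟨e, he⟩ := exists_mem_below (q := q) hc a
    obtain ⟨z, hz, hzR⟩ := left_iff.1 (hi e (below_subset_locus he)).1
    have hRe := hR.of_mem_below ha he
    have haz : p.ord.lt a z := (lt_or_le (p.locus_subset ha) (p.locus_subset hz)).resolve_right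
      fun hle => hzR a ha (rev_le.2 hle) hRe
    exact (hzR z hz (.inr rfl) (hR.of_mem_below hz (h.2 a ha z hz haz he))).elim

/-! ### The quotients -/

theorem prec_self_irrefl (hc : CompactOver L A) (hL : Linked p q) (hb : b ∈ locus q.type) :
    ¬ Prec q q b b := fun h => q.ord.irrefl _ (h.lt hc hL hb hb)

theorem Linked.dep_comm (hc : CompactOver L A) (hL : Linked p q) (ha : a ∈ locus p.type)
    (hb : b ∈ locus q.type) : Dep L A b a ↔ Dep L A a b := by
  rw [dep_iff_prec hc hL ha hb, dep_iff_prec hc (hL.symm hc) hb ha, and_comm]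

theorem dep_trans (hc : CompactOver L A) (hL : Linked p q) (hL' : Linked q r) (hL'' : Linked p r)
    (ha : a ∈ locus p.type)
    (hb : b ∈ locus q.type) (hr : c ∈ locus r.type) (h : Dep L A a b) (h' : Dep L A b c) :
    Dep L A a c := by
  rw [dep_iff_prec hc (hL.symm hc) hb ha] at h
  rw [dep_iff_prec hc (hL'.symm hc) hr hb] at h'
  rw [dep_iff_prec hc (hL''.symm hc) hr ha]
  exact ⟨Prec.not_trans h.1 h'.1 hb, Prec.not_trans h'.2 h.2 hb⟩

variable {p q r s : SOPair L A} {a b c x y : C} {N : Set C}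

/-- If `x ≺ y` failed, the three failures would compose to the failure of `a ≺ b`. In particular `≺`
does not change when elements are replaced by dependent ones. -/
theorem Prec.congr (h : Prec p q a b) (hax : ¬ Prec p r a x) (hyb : ¬ Prec s q y b)
    (hx : x ∈ locus r.type) (hy : y ∈ locus s.type) : Prec r s x y :=
  by_contra fun hn => Prec.not_trans (Prec.not_trans hax hn hx) hyb hy h

theorem dep_self (hc : CompactOver L A) (hL : Linked p q) (hb : b ∈ locus q.type) :
    Dep L A b b :=
  (dep_iff_prec hc (hL.self_right hc) hb hb).2
    ⟨prec_self_irrefl hc hL hb, prec_self_irrefl hc hL hb⟩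

theorem mem_cls_self (hc : CompactOver L A) (hL : Linked p q) (hb : b ∈ q.locusIn N) :
    b ∈ q.cls N b := ⟨hb, dep_self hc hL hb.1⟩

theorem cls_subset_of_dep (hc : CompactOver L A) (hL : Linked p q)
    (ha : a ∈ locus p.type) (hb : b ∈ locus p.type) (h : Dep L A a b) :
    q.cls N a ⊆ q.cls N b := fun _ hx =>
  ⟨hx.1, dep_trans hc (hL.symm hc) (hL.self_left hc) (hL.symm hc) hx.1.1 ha hb hx.2 h⟩

theorem cls_eq_of_dep (hc : CompactOver L A) (hL : Linked p q)
    (ha : a ∈ locus p.type) (hb : b ∈ locus p.type) (h : Dep L A a b) :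
    q.cls N a = q.cls N b :=
  (cls_subset_of_dep hc hL ha hb h).antisymm
    (cls_subset_of_dep hc hL hb ha (((hL.self_left hc).dep_comm hc ha hb).2 h))

theorem cls_eq_cls_of_dep (hc : CompactOver L A) (hL : Linked p q) (ha : a ∈ locus p.type)
    (hb : b ∈ locus q.type) (h : Dep L A b a) : q.cls N a = q.cls N b := by
  have hab := (hL.dep_comm hc ha hb).1 h
  ext x
  exact ⟨fun hx => ⟨hx.1, dep_trans hc (hL.symm hc) hL (hL.self_right hc) hx.1.1 ha hb hx.2 hab⟩,
    fun hx => ⟨hx.1, dep_trans hc (hL.self_right hc) (hL.symm hc) (hL.symm hc) hx.1.1 hb ha hx.2 h⟩⟩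

theorem cls_eq_iff (hc : CompactOver L A) (hL : Linked p q) (ha : a ∈ q.locusIn N)
    (hb : b ∈ q.locusIn N) : q.cls N a = q.cls N b ↔ Dep L A a b := by
  refine ⟨fun h => ?_, cls_eq_of_dep hc (hL.self_right hc) ha.1 hb.1⟩
  have := mem_cls_self hc hL ha
  rw [h] at this
  exact this.2

theorem classLT_iff (hc : CompactOver L A) (hL : Linked p q) {X Y : q.classes N}
    (ha : a ∈ q.locusIn N) (hb : b ∈ q.locusIn N) (hX : X.1 = q.cls N a) (hY : Y.1 = q.cls N b) :
    q.classLT N X Y ↔ Prec q q a b := by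
  have hLq := hL.self_right hc
  have haX : a ∈ X.1 := hX ▸ mem_cls_self hc hL ha
  have hbY : b ∈ Y.1 := hY ▸ mem_cls_self hc hL hb
  constructor
  · intro h
    by_contra hn
    by_cases hba : Prec q q b a
    · exact q.ord.asymm (h a haX b hbY) (hba.lt hc hL hb.1 ha.1)
    · have hd : Dep L A b a := (dep_iff_prec hc hLq ha.1 hb.1).2 ⟨hba, hn⟩
      have hbX : b ∈ X.1 := hX ▸ ⟨hb, hd⟩
      exact q.ord.irrefl _ (h b hbX b hbY)
  · intro h x hx y hy
    rw [hX] at hx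
    rw [hY] at hy
    exact (h.congr ((dep_iff_prec hc hLq ha.1 hx.1.1).1 hx.2).2
      ((dep_iff_prec hc hLq hb.1 hy.1.1).1 hy.2).1 hx.1.1 hy.1.1).lt hc hL hx.1.1 hy.1.1

theorem Linked.isOrderedQuotient (hc : CompactOver L A) (hL : Linked p q) (N : Set C) :
    q.IsOrderedQuotient N := by
  have hLq := hL.self_right hc
  refine ⟨⟨fun x => dep_self hc hL x.2.1, fun {x y} h => (hLq.dep_comm hc y.2.1 x.2.1).1 h,
    fun {x y z} h h' => dep_trans hc hLq hLq hLq x.2.1 y.2.1 z.2.1 h h'⟩, ?_⟩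
  refine { trichotomous := ?_, irrefl := ?_, trans := ?_ }
  · rintro X Y h h'
    obtain ⟨a, ha, hX⟩ := X.2
    obtain ⟨b, hb, hY⟩ := Y.2
    rw [classLT_iff hc hL ha hb hX hY] at h
    rw [classLT_iff hc hL hb ha hY hX] at h'
    apply Subtype.ext
    rw [hX, hY, cls_eq_iff hc hL ha hb, dep_iff_prec hc hLq hb.1 ha.1]
    exact ⟨h, h'⟩
  · rintro X
    obtain ⟨a, ha, hX⟩ := X.2
    rw [classLT_iff hc hL ha ha hX hX]
    exact prec_self_irrefl hc hL ha.1
  · rintro X Y Z h h'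
    obtain ⟨a, ha, hX⟩ := X.2
    obtain ⟨b, hb, hY⟩ := Y.2
    obtain ⟨c, hz, hZ⟩ := Z.2
    rw [classLT_iff hc hL ha hb hX hY] at h
    rw [classLT_iff hc hL hb hz hY hZ] at h'
    rw [classLT_iff hc hL ha hz hX hZ]
    exact h.trans hc hLq ha.1 h'

/-! ### The canonical isomorphism -/

/-- A class goes to the class of any element dependent on it. Transitivity of dependence across the
types makes the two assignments mutually inverse, and `Prec.congr` transports the order. -/
theorem canonicalIso_of_exists_dep (hc : CompactOver L A) (hL : Linked p q)
    (hp : ∀ a ∈ p.locusIn N, ∃ b ∈ q.locusIn N, Dep L A b a)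
    (hq : ∀ b ∈ q.locusIn N, ∃ a ∈ p.locusIn N, Dep L A a b) : p.CanonicalIso q N := by
  have hL' := hL.symm hc
  choose k hk hkX using fun X : p.classes N => X.2
  choose l hl hlY using fun Y : q.classes N => Y.2
  have hpc : ∀ a ∈ p.locusIn N, q.cls N a ∈ q.classes N := fun a ha =>
    let ⟨b, hb, hab⟩ := hp a ha
    ⟨b, hb, cls_eq_cls_of_dep hc hL ha.1 hb.1 hab⟩
  have hqc : ∀ b ∈ q.locusIn N, p.cls N b ∈ p.classes N := fun b hb =>
    let ⟨a, ha, hab⟩ := hq b hb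
    ⟨a, ha, cls_eq_cls_of_dep hc hL' hb.1 ha.1 hab⟩
  let f : p.classes N → q.classes N := fun X => ⟨q.cls N (k X), hpc _ (hk X)⟩
  let g : q.classes N → p.classes N := fun Y => ⟨p.cls N (l Y), hqc _ (hl Y)⟩
  have hfd : ∀ X, Dep L A (l (f X)) (k X) := fun X =>
    have : l (f X) ∈ (f X).1 := (hlY (f X)) ▸ mem_cls_self hc hL (hl (f X))
    this.2
  have hgd : ∀ Y, Dep L A (k (g Y)) (l Y) := fun Y =>
    have : k (g Y) ∈ (g Y).1 := (hkX (g Y)) ▸ mem_cls_self hc hL' (hk (g Y))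
    this.2
  refine ⟨⟨⟨f, g, fun X => ?_, fun Y => ?_⟩, fun {X Y} => ?_⟩, fun X a ha hX => ?_⟩
  · apply Subtype.ext
    rw [hkX X]
    exact cls_eq_cls_of_dep hc hL' (hl _).1 (hk X).1
      ((hL'.dep_comm hc (hl _).1 (hk X).1).2 (hfd X))
  · apply Subtype.ext
    rw [hlY Y]
    exact cls_eq_cls_of_dep hc hL (hk _).1 (hl Y).1
      ((hL.dep_comm hc (hk _).1 (hl Y).1).2 (hgd Y))
  · have h₁ := (dep_iff_prec hc hL (hk X).1 (hl (f X)).1).1 (hfd X)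
    have h₂ := (dep_iff_prec hc hL (hk Y).1 (hl (f Y)).1).1 (hfd Y)
    rw [classLT_iff hc hL' (hk X) (hk Y) (hkX X) (hkX Y)]
    refine (classLT_iff hc hL (hl (f X)) (hl (f Y)) (hlY (f X)) (hlY (f Y))).trans
      ⟨fun h => h.congr h₁.1 h₂.2 (hk X).1 (hk Y).1,
        fun h => h.congr h₁.2 h₂.1 (hl _).1 (hl _).1⟩
  · refine cls_eq_of_dep hc hL (hk X).1 ha.1 ?_
    rw [← cls_eq_iff hc hL' (hk X) ha, ← hkX X, hX]

/-! ### Finding dependent elements, also inside a model -/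

/-- Dependence of `b` on `a` is witnessed by two families that separate `b` from the ends. -/
theorem dep_iff_exists_monoFam (hc : CompactOver L A) (hL : Linked p q) (ha : a ∈ locus p.type)
    (hb : b ∈ locus q.type) :
    Dep L A b a ↔ ∃ R R', MonoFam p q R ∧ MonoFam p q R' ∧ R a b ∧ ¬ R' a b := by
  rw [dep_iff_prec hc hL ha hb]
  simp only [Prec, not_forall, not_not]
  constructor
  · rintro ⟨⟨R', hR', h'⟩, R, hR, h⟩
    exact ⟨R, _, hR, hR'.dual hc, h, not_not.2 h'⟩
  · rintro ⟨R, R', hR, hR', h, h'⟩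
    exact ⟨⟨_, hR'.dual hc, h'⟩, R, hR, h⟩

theorem exists_dep_of_dep (hc : CompactOver L A) (hL : Linked p q) (ha : a ∈ locus p.type)
    (hb : b ∈ locus q.type) (h : Dep L A b a) (hx : x ∈ locus p.type) :
    ∃ y ∈ locus q.type, Dep L A y x := by
  obtain ⟨R, R', hR, hR', h, h'⟩ := (dep_iff_exists_monoFam hc hL ha hb).1 h
  obtain ⟨y, hy, hyx⟩ := hc.transfer (R := fun a b => R a b ∧ ¬ R' a b)
    (definable_and hR.definable (definable_not hR'.definable)) ha hb ⟨h, h'⟩ hx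
  exact ⟨y, hy, (dep_iff_exists_monoFam hc hL hx hy).2 ⟨R, R', hR, hR', hyx⟩⟩

theorem exists_dep_of_not_forkOrth (hc : CompactOver L A) (hL : Linked p q)
    (h : ¬ ForkOrth p.type q.type) :
    (∀ a ∈ locus p.type, ∃ b ∈ locus q.type, Dep L A b a) ∧
      ∀ b ∈ locus q.type, ∃ a ∈ locus p.type, Dep L A a b := by
  simp only [ForkOrth, not_forall, not_not] at h
  obtain ⟨a, ha, b, hb, h⟩ := h
  exact ⟨fun x hx => exists_dep_of_dep hc hL ha hb ((hL.dep_comm hc ha hb).2 h) hx,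
    fun y hy => exists_dep_of_dep hc (hL.symm hc) hb ha h hy⟩

/-- In a convex order on a stationarily ordered type, the elements of the type that lie strictly
between `e₁` and `e₂` in the sense of `Prec` lie between two realizations. -/
theorem exists_bounds_of_witnessesConvex (hc : CompactOver L A) (hL : Linked p q)
    {O : DefLinOrder L A} (hO : O.WitnessesConvex q.type) {e₁ e₂ : C} (h₁ : e₁ ∈ locus q.type)
    (h₂ : e₂ ∈ locus q.type) :
    ∃ d₁ ∈ locus q.type, ∃ d₂ ∈ locus q.type, ∀ y ∈ locus q.type,
      Prec q q e₁ y → Prec q q y e₂ → O.lt d₁ y ∧ O.lt y d₂ := by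
  have hLq := hL.self_right hc
  have hdef : A.Definable₂ L {z : C × C | O.lt z.1 z.2} := O.lt_definable
  -- `O` need not be the order of `q`. By invariance of the left end type it either agrees with that
  -- order on all `≺`-separated pairs or reverses it on all of them; in the second case the bounds
  -- trade places.
  rcases q.left {x | O.lt x e₁} (rel_definable' hdef e₁) with h | h
  · have hall : ∀ x ∈ locus q.type, ∀ y ∈ locus q.type, Prec q q x y → O.lt x y := by
      intro x hx y hy hxy
      have hl := Left.congr_rel (p := q) hc ((mem_locus_iff h₁).1 hy) hdef h
      exact mem_below_iff.1 ((mem_below_iff_prec hc hLq hy hx).2 hxy)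
        (fun y x => O.lt x y) (definable₂_swap hdef) hl
    exact ⟨e₁, h₁, e₂, h₂, fun y hy hy₁ hy₂ => ⟨hall _ h₁ _ hy hy₁, hall _ hy _ h₂ hy₂⟩⟩
  · have hall : ∀ x ∈ locus q.type, ∀ y ∈ locus q.type, Prec q q x y → O.lt y x := by
      intro x hx y hy hxy
      have hl := Left.congr_rel (p := q) hc ((mem_locus_iff h₁).1 hy) (R := fun x y => ¬ O.lt x y)
        (definable₂_not hdef) h
      have := mem_below_iff.1 ((mem_below_iff_prec hc hLq hy hx).2 hxy)
        (fun y x => ¬ O.lt x y)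
        (definable₂_not (R := fun y x => O.lt x y) (definable₂_swap hdef)) hl
      rcases O.total x (hO.1 hx) y (hO.1 hy) with h | rfl | h
      exacts [(this h).elim, (prec_self_irrefl hc hL hx hxy).elim, h]
    exact ⟨e₂, h₂, e₁, h₁, fun y hy hy₁ hy₂ => ⟨hall _ hy _ h₂ hy₂, hall _ h₁ _ hy hy₁⟩⟩

/-- The witnessing set `R a \ R' a` need not lie inside `q(C)`, but its intersection with a suitable
`A`-definable neighbourhood of `q(C)` lies in an `O`-interval with ends in `q(C)`. The model meets
this intersection, and by convexity the point found realizes `q`. -/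
theorem exists_dep_in_model (hc : CompactOver L A) (hL : Linked p q) (hq : IsConvexType q.type)
    {M : L.ElementarySubstructure C} (hM : A ⊆ (M : Set C)) (ha : a ∈ p.locusIn M)
    (hb : b ∈ locus q.type) (h : Dep L A b a) : ∃ b' ∈ q.locusIn M, Dep L A b' a := by
  obtain ⟨O, hO⟩ := hq
  have hLq := hL.self_right hc
  obtain ⟨R, R', hR, hR', h, h'⟩ := (dep_iff_exists_monoFam hc hL ha.1 hb).1 h
  obtain ⟨c₁, hc₁, hRc₁⟩ := hR'.nonempty a ha.1
  obtain ⟨c₂, hc₂, hRc₂⟩ := hR.bounded a ha.1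
  -- `O` is controlled only on `≺`-separated pairs, so the bounds `c₁`, `c₂` are moved outwards to
  -- `e₁ ≺ c₁` and `c₂ ≺ e₂`.
  obtain ⟨e₁, he₁⟩ := exists_mem_below (q := q) hc c₁
  obtain ⟨e₂, he₂⟩ := exists_mem_below (q := q.rev) hc c₂
  have hq₁ := below_subset_locus he₁
  have hq₂ : e₂ ∈ locus q.type := below_subset_locus (p := q.rev) he₂
  have hp₁ := (mem_below_iff_prec hc hLq hc₁ hq₁).1 he₁
  have hp₂ := (mem_rev_below_iff_prec hc hLq hc₂ hq₂).1 he₂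
  obtain ⟨d₁, hd₁, d₂, hd₂, hd⟩ := exists_bounds_of_witnessesConvex hc hL hO hq₁ hq₂
  have hnot : ∀ x ∈ locus q.type, ∀ y ∈ locus q.type, q.ord.lt x y → ¬ Prec q q y x :=
    fun x hx y hy hxy h => q.ord.asymm hxy (h.lt hc hL hy hx)
  have hbd : ∀ y ∈ locus q.type, R a y ∧ ¬ R' a y → O.lt d₁ y ∧ O.lt y d₂ := by
    rintro y hy ⟨hRy, hRy'⟩
    have hy₁ := hR'.lt_of_mem hRc₁ hRy' (q.locus_subset hc₁) (q.locus_subset hy)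
    have hy₂ := hR.lt_of_mem hRy hRc₂ (q.locus_subset hy) (q.locus_subset hc₂)
    exact hd y hy (hp₁.congr (prec_self_irrefl hc hL hq₁) (hnot _ hc₁ _ hy hy₁) hq₁ hy)
      (hp₂.congr (hnot _ hy _ hc₂ hy₂) (prec_self_irrefl hc hL hq₂) hy hq₂)
  have hXdef : ∀ {B : Set C}, A ⊆ B → a ∈ B → B.Definable₁ L {y | R a y ∧ ¬ R' a y} :=
    fun hAB haB => definable_and
      (definable_rel hR.definable hAB (L.definableFun_const _ haB) (.proj L))
      (definable_not (definable_rel hR'.definable hAB (L.definableFun_const _ haB) (.proj L)))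
  have hOdef := O.lt_definable
  obtain ⟨U, hU, hqU, hUX⟩ := hc.exists_neighborhood q.type
    (X := {y | (R a y ∧ ¬ R' a y) → O.lt d₁ y ∧ O.lt y d₂})
    (definable_imp (hXdef (subset_univ _) trivial) (definable_and
      (definable_rel hOdef (subset_univ _) (L.definableFun_const _ trivial) (.proj L))
      (definable_rel hOdef (subset_univ _) (.proj L) (L.definableFun_const _ trivial)))) hbd
  obtain ⟨b', hb', hbM⟩ := M.meetsDefinable (D := {y | (R a y ∧ ¬ R' a y) ∧ y ∈ U})
    ⟨b, ⟨h, h'⟩, hqU hb⟩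
    (definable_and (hXdef hM ha.2) (definable_mem hU hM (.proj L)))
  have hlt := hUX hb'.2 hb'.1
  have hbq := hO.2 d₁ hd₁ d₂ hd₂ b' hlt.1 hlt.2
  exact ⟨b', ⟨hbq, hbM⟩, (dep_iff_exists_monoFam hc hL ha.1 hbq).2 ⟨R, R', hR, hR', hb'.1⟩⟩

theorem exists_linearOrder_type_eq {α β : Type w} {r : α → α → Prop} {t : β → β → Prop}
    (hr : IsStrictTotalOrder α r) (ht : IsStrictTotalOrder β t) (f : r ≃r t) :
    ∃ (O : LinearOrder α) (O' : LinearOrder β), (∀ x y, O.lt x y ↔ r x y) ∧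
      (∀ x y, O'.lt x y ↔ t x y) ∧ @OrderType.type α O = @OrderType.type β O' := by
  classical
  let O := linearOrderOfSTO r
  let O' := linearOrderOfSTO t
  exact ⟨O, O', fun _ _ => Iff.rfl, fun _ _ => Iff.rfl, OrderType.type_congr
    (OrderIso.ofRelIsoLT (α := α) (β := β) f)⟩

theorem CanonicalIso.exists_hasInvariant (hp : p.IsOrderedQuotient N)
    (hq : q.IsOrderedQuotient N) (h : p.CanonicalIso q N) :
    ∃ τ : OrderType.{w}, p.HasInvariant N τ ∧ q.HasInvariant N τ := by
  obtain ⟨f, -⟩ := h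
  obtain ⟨O, O', h₁, h₂, h₃⟩ := exists_linearOrder_type_eq hp.2 hq.2 f
  exact ⟨_, ⟨O, h₁, rfl⟩, O', h₂, h₃.symm⟩

variable {p q : SOPair L A} {R : C → C → Prop} {a a' b b' : C} {M : L.ElementarySubstructure C}

/-! ### Shuffled pairs -/

theorem IsConvex.rev (h : p.IsConvex) : p.rev.IsConvex :=
  ⟨h.1, fun x hx z hz y hxy hyz => h.2 z hz x hx y hyz hxy⟩

/-- Linked convex pairs such that any realization of the one type is comparable with any
realization of the other. -/
structure Shuffled (p q : SOPair L A) : Prop where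
  linked : Linked p q
  prec_or : ∀ a ∈ locus p.type, ∀ b ∈ locus q.type, Prec p q a b ∨ Prec q p b a
  left_convex : p.IsConvex
  right_convex : q.IsConvex

theorem Shuffled.symm (hc : CompactOver L A) (h : Shuffled p q) : Shuffled q p :=
  ⟨h.linked.symm hc, fun b hb a ha => (h.prec_or a ha b hb).symm, h.right_convex, h.left_convex⟩

theorem Shuffled.rev (hc : CompactOver L A) (h : Shuffled p q) : Shuffled p.rev q.rev :=
  ⟨h.linked.rev, fun a ha b hb => by
    rw [prec_rev hc, prec_rev hc]
    exact (h.prec_or a ha b hb).symm, h.left_convex.rev, h.right_convex.rev⟩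

theorem DirectlyShuffled.shuffled (hc : CompactOver L A) (h : p.DirectlyShuffled q)
    (hp : p.IsConvex) (hq : q.IsConvex) : Shuffled p q := by
  have hL := h.1.linked hc
  refine ⟨hL, fun a ha b hb => ?_, hp, hq⟩
  have := h.2.2 a ha b hb
  rw [dep_iff_prec hc (hL.symm hc) hb ha] at this
  tauto

/-- As realizations of different types are always comparable, one formula decides `≺` between them;
this lets `≺` be expressed inside a model. -/
theorem Shuffled.mem_iff (hc : CompactOver L A) (h : Shuffled p q) (hR : MonoFam q p R)
    (ha : a ∈ locus p.type) (hb : b ∈ locus q.type) : R b a ↔ Prec p q a b :=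
  ⟨fun hba => (h.prec_or a ha b hb).resolve_right fun h' => h' R hR hba,
    fun h' => not_not.1 (h' _ (hR.dual hc))⟩

theorem Shuffled.notMem_iff (hc : CompactOver L A) (h : Shuffled p q) (hR : MonoFam q p R)
    (ha : a ∈ locus p.type) (hb : b ∈ locus q.type) : ¬ R b a ↔ Prec q p b a :=
  ⟨fun hba => (h.prec_or a ha b hb).resolve_left fun h' => hba ((h.mem_iff hc hR ha hb).2 h'),
    fun h' => h' R hR⟩

/-! ### Points of a model between given ones -/

/-- The family comparing the members of an increasing family by inclusion. -/
theorem MonoFam.compare (hc : CompactOver L A) (hR : MonoFam q p R) :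
    MonoFam q q fun b b' => ∀ a, a ∈ p.ord.dom → R b' a → R b a where
  definable := definable_forall <|
    definable_imp (definable_mem p.ord.dom_definable subset_rfl (.proj L)) <|
      definable_imp (definable_rel hR.definable subset_rfl (.proj L) (.proj L))
        (definable_rel hR.definable subset_rfl (.proj L) (.proj L))
  down _ _ _ hlt h a ha hR' := h a ha (hR.mono _ _ _ hlt hR')
  nonempty b hb := ⟨b, hb, fun _ _ h => h⟩
  bounded b hb := by
    obtain ⟨a, ha, hba⟩ := hR.bounded b hb
    obtain ⟨b', hb', hba'⟩ := (hR.dual hc).bounded a ha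
    exact ⟨b', hb', fun h => hba (h a (p.locus_subset ha) (not_not.1 hba'))⟩
  mono _ _ _ hlt h a ha hR' := hR.mono _ _ _ hlt (h a ha hR')

/-- The intersection of the members of an increasing family at the indices that another family
places above the given one. -/
theorem MonoFam.inter_above (hR : MonoFam q p R) {T : C → C → Prop} (hT : MonoFam q q T)
    (hTr : ∀ b ∈ locus q.type, T b b) :
    MonoFam q p fun b a => ∀ b', b' ∈ q.ord.dom → ¬ T b b' → R b' a where
  definable := definable_forall <|
    definable_imp (definable_mem q.ord.dom_definable subset_rfl (.proj L)) <|
      definable_imp (definable_not (definable_rel hT.definable subset_rfl (.proj L) (.proj L)))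
        (definable_rel hR.definable subset_rfl (.proj L) (.proj L))
  down _ _ _ hlt h b' hb' hn := hR.down _ _ _ hlt (h b' hb' hn)
  nonempty b hb := by
    obtain ⟨a, ha, hba⟩ := hR.nonempty b hb
    exact ⟨a, ha, fun b' hb' hn =>
      hR.mono _ _ _ (hT.lt_of_mem (hTr b hb) hn (q.locus_subset hb) hb') hba⟩
  bounded b hb := by
    obtain ⟨b', hb', hn⟩ := hT.bounded b hb
    obtain ⟨a, ha, hba⟩ := hR.bounded b' hb'
    exact ⟨a, ha, fun h => hba (h b' (q.locus_subset hb') hn)⟩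
  mono _ _ _ hlt h b' hb' hn := h b' hb' fun hT' => hn (hT.mono _ _ _ hlt hT')

theorem Fam.mem_locus_of_convex (hp : p.IsConvex) (hR : Fam q p R) (hb : b ∈ locus q.type)
    (hb' : b' ∈ locus q.type) (ha : a ∈ p.ord.dom) (h : ¬ R b a) (h' : R b' a) :
    a ∈ locus p.type := by
  obtain ⟨a₀, ha₀, h₀⟩ := hR.nonempty b hb
  obtain ⟨a₁, ha₁, h₁⟩ := hR.bounded b' hb'
  exact hp.2 a₀ ha₀ a₁ ha₁ a (hR.lt_of_mem h₀ h (p.locus_subset ha₀) ha)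
    (hR.lt_of_mem h' h₁ ha (p.locus_subset ha₁))

/-- Applied to the comparison family, `b ≺ b'` says that the set at `b'` is not contained in the one
at `b`. The model contains a point of the difference, which realizes `p` by convexity. -/
theorem Shuffled.exists_left_between (hc : CompactOver L A) (h : Shuffled p q)
    (hM : A ⊆ (M : Set C)) (hb : b ∈ q.locusIn M) (hb' : b' ∈ q.locusIn M)
    (hbb : Prec q q b b') : ∃ a ∈ p.locusIn M, Prec q p b a ∧ Prec p q a b' := by
  obtain ⟨R, hR⟩ := h.linked.symm hc
  have := hbb _ (hR.compare hc)
  push Not at this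
  obtain ⟨a, haM, haD⟩ := M.meetsDefinable (D := {a | a ∈ p.ord.dom ∧ R b' a ∧ ¬ R b a}) this
    (definable_and (definable_mem p.ord.dom_definable hM (.proj L)) <|
      definable_and (definable_rel hR.definable hM (L.definableFun_const _ hb'.2) (.proj L))
        (definable_not (definable_rel hR.definable hM (L.definableFun_const _ hb.2) (.proj L))))
  have ha := hR.mem_locus_of_convex h.left_convex hb.1 hb'.1 haM.1 haM.2.2 haM.2.1
  exact ⟨a, ⟨ha, haD⟩, (h.notMem_iff hc hR ha hb.1).1 haM.2.2, (h.mem_iff hc hR ha hb'.1).1 haM.2.1⟩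

/-- Since `Prec` speaks about all monotone families, it can be applied to the intersection of the
members above `b`: as `a` is not in it, `a` is already outside some member strictly above `b`. -/
theorem Shuffled.exists_right_between (hc : CompactOver L A) (h : Shuffled p q)
    (hM : A ⊆ (M : Set C)) (hb : b ∈ q.locusIn M) (ha : a ∈ p.locusIn M)
    (hba : Prec q p b a) : ∃ b' ∈ q.locusIn M, Prec q q b b' ∧ Prec q p b' a := by
  obtain ⟨R, hR⟩ := h.linked.symm hc
  have hT := hR.compare hc
  have := hba _ (hR.inter_above hT fun _ _ _ _ h => h)
  simp only [not_forall] at this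
  obtain ⟨b₀, hb₀, hn, hba₀⟩ := this
  obtain ⟨b', ⟨hbd, hn, hba'⟩, hbM⟩ := M.meetsDefinable
    (D := {b' | b' ∈ q.ord.dom ∧ ¬ (∀ a, a ∈ p.ord.dom → R b' a → R b a) ∧ ¬ R b' a})
    ⟨b₀, hb₀, by simpa only [not_forall] using hn, hba₀⟩
    (definable_and (definable_mem q.ord.dom_definable hM (.proj L)) <|
      definable_and
        (definable_not (definable_rel (R := fun b b' => ∀ a, a ∈ p.ord.dom → R b' a → R b a)
          hT.definable hM (L.definableFun_const _ hb.2) (.proj L)))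
        (definable_not (definable_rel hR.definable hM (.proj L) (L.definableFun_const _ ha.2))))
  obtain ⟨b₁, hb₁, hba₁⟩ := (hR.dual hc).bounded a ha.1
  have hbq : b' ∈ locus q.type :=
    h.right_convex.2 b hb.1 b₁ hb₁ b'
      (hT.lt_of_mem (fun _ _ h => h) hn (q.locus_subset hb.1) hbd)
      ((hR.dual hc).lt_of_mem hba' hba₁ hbd (q.locus_subset hb₁))
  -- A point in the member at `b'` but not in the one at `b` lies `≺`-between them, so strict
  -- inclusion of the members yields `b ≺ b'`.
  push Not at hn
  obtain ⟨a', had, hRa', hRa⟩ := hn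
  have ha' := hR.mem_locus_of_convex h.left_convex hb.1 hbq had hRa hRa'
  exact ⟨b', ⟨hbq, hbM⟩, ((h.notMem_iff hc hR ha' hb.1).1 hRa).trans hc (h.linked.symm hc) hb.1
    ((h.mem_iff hc hR ha' hbq).1 hRa'), (h.notMem_iff hc hR ha.1 hbq).1 hba'⟩

theorem Shuffled.exists_right_between' (hc : CompactOver L A) (h : Shuffled p q)
    (hM : A ⊆ (M : Set C)) (hb : b ∈ q.locusIn M) (ha : a ∈ p.locusIn M)
    (hab : Prec p q a b) : ∃ b' ∈ q.locusIn M, Prec p q a b' ∧ Prec q q b' b := by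
  obtain ⟨b', hb', h₁, h₂⟩ := (h.rev hc).exists_right_between hc hM hb ha ((prec_rev hc).2 hab)
  exact ⟨b', hb', (prec_rev hc).1 h₂, (prec_rev hc).1 h₁⟩

/-! ### The shuffling relation on the classes -/

theorem Shuffled.exists_prec_of_two_le (hc : CompactOver L A) (h : Shuffled p q) {N : Set C}
    (h₂ : 2 ≤ (q.classes N).encard) :
    ∃ b ∈ q.locusIn N, ∃ b' ∈ q.locusIn N, Prec q q b b' := by
  have hL := h.linked
  obtain ⟨_, _, ⟨b, hb, rfl⟩, ⟨b', hb', rfl⟩, hne⟩ := Set.one_lt_encard_iff.1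
    ((by norm_num : (1 : ℕ∞) < 2).trans_le h₂)
  rw [Ne, cls_eq_iff hc hL hb hb', dep_iff_prec hc (hL.self_right hc) hb'.1 hb.1] at hne
  by_cases h' : Prec q q b b'
  · exact ⟨b, hb, b', hb', h'⟩
  · exact ⟨b', hb', b, hb, by tauto⟩

theorem Shuffled.sHat_iff (hc : CompactOver L A) (h : Shuffled p q) {N : Set C}
    {X : p.classes N} {Y : q.classes N} (ha : a ∈ p.locusIn N) (hb : b ∈ q.locusIn N)
    (hX : X.1 = p.cls N a) (hY : Y.1 = q.cls N b) : p.SHat q N X Y ↔ Prec p q a b := by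
  have hL := h.linked
  have hL' := hL.symm hc
  constructor
  · rintro ⟨a', ha', b', hb', ⟨-, -, hS⟩, hX', hY'⟩
    rw [mem_below_iff_prec hc hL' hb'.1 ha'.1] at hS
    have haa := (cls_eq_iff hc hL' ha' ha).1 (hX'.symm.trans hX)
    have hbb := (cls_eq_iff hc hL hb' hb).1 (hY'.symm.trans hY)
    rw [dep_iff_prec hc (hL.self_left hc) ha.1 ha'.1] at haa
    rw [dep_iff_prec hc (hL.self_right hc) hb.1 hb'.1] at hbb
    exact hS.congr haa.1 hbb.2 ha.1 hb.1
  · intro hab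
    exact ⟨a, ha, b, hb, ⟨ha.1, hb.1, (mem_below_iff_prec hc hL' hb.1 ha.1).2 hab⟩, hX, hY⟩

theorem infinite_of_forall_exists {α : Type*} {r : α → α → Prop} [IsTrans α r] [Std.Irrefl r]
    {T : Set α} (hT : T.Nonempty) (h : ∀ x ∈ T, ∃ y ∈ T, r y x) : Infinite α := by
  by_contra hfin
  rw [not_infinite_iff_finite] at hfin
  obtain ⟨x, hx, hmin⟩ := (Finite.wellFounded_of_trans_of_irrefl r).has_min T hT
  obtain ⟨y, hy, hyx⟩ := h x hx
  exact hmin y hy hyx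

/-- The classes above `a` form a non-empty set without a least element. -/
theorem Shuffled.infinite_right (hc : CompactOver L A) (h : Shuffled p q)
    (hM : A ⊆ (M : Set C)) (hb : b ∈ q.locusIn M) (ha : a ∈ p.locusIn M)
    (hab : Prec p q a b) : Infinite (q.classes (M : Set C)) := by
  have := (h.linked.isOrderedQuotient hc (M : Set C)).2
  refine infinite_of_forall_exists (r := q.classLT (M : Set C))
    (T := {Y | ∃ b ∈ q.locusIn M, Prec p q a b ∧ Y.1 = q.cls M b})
    ⟨⟨q.cls M b, b, hb, rfl⟩, b, hb, hab, rfl⟩ ?_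
  rintro Y ⟨b, hb, hab, hY⟩
  obtain ⟨b', hb', h₁, h₂⟩ := h.exists_right_between' hc hM hb ha hab
  exact ⟨⟨q.cls M b', b', hb', rfl⟩, ⟨b', hb', h₁, rfl⟩,
    (classLT_iff hc h.linked hb' hb rfl hY).2 h₂⟩

theorem Shuffled.infinite_left (hc : CompactOver L A) (h : Shuffled p q)
    (hM : A ⊆ (M : Set C)) (hb : b ∈ q.locusIn M) (ha : a ∈ p.locusIn M)
    (hab : Prec q p b a) : Infinite (p.classes (M : Set C)) :=
  (h.symm hc).infinite_right hc hM ha hb hab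

theorem Shuffled.isShuffling (hc : CompactOver L A) (h : Shuffled p q)
    (hM : A ⊆ (M : Set C)) (hb : b ∈ q.locusIn M) (ha : a ∈ p.locusIn M) (hab : Prec p q a b) :
    IsShuffling (p.classLT (M : Set C)) (q.classLT (M : Set C)) (p.SHat q (M : Set C)) := by
  have hL := h.linked
  have hL' := hL.symm hc
  have hLp := hL.self_left hc
  have hLq := hL.self_right hc
  have h' := h.symm hc
  have hop := (hL'.isOrderedQuotient hc (M : Set C)).2
  have hoq := (hL.isOrderedQuotient hc (M : Set C)).2
  refine ⟨hop, hoq, ?_, ?_, ?_, ?_, ?_, ?_⟩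
  · exact ⟨⟨_, a, ha, rfl⟩, ⟨_, b, hb, rfl⟩, (h.sHat_iff hc ha hb rfl rfl).2 hab⟩
  · rintro ⟨_, b, hb, rfl⟩ ⟨_, a, ha, rfl⟩ hX ⟨_, a', ha', rfl⟩ hlt
    rw [Set.mem_ofPred_eq, h.sHat_iff hc ha hb rfl rfl] at hX
    rw [classLT_iff hc hL' ha' ha rfl rfl] at hlt
    exact (h.sHat_iff hc ha' hb rfl rfl).2 (hlt.trans hc hLp ha'.1 hX)
  · rintro ⟨_, b, hb, rfl⟩ ⟨_, b', hb', rfl⟩ hlt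
    rw [classLT_iff hc hL hb hb' rfl rfl] at hlt
    refine Set.ssubset_iff_subset_ne.2 ⟨?_, fun heq => ?_⟩
    · rintro ⟨_, a, ha, rfl⟩ hX
      rw [Set.mem_ofPred_eq, h.sHat_iff hc ha hb rfl rfl] at hX
      exact (h.sHat_iff hc ha hb' rfl rfl).2 (hX.trans hc hL ha.1 hlt)
    · obtain ⟨a, ha, h₁, h₂⟩ := h.exists_left_between hc hM hb hb' hlt
      have hX : (⟨_, a, ha, rfl⟩ : p.classes (M : Set C)) ∈ {X | p.SHat q M X ⟨_, b, hb, rfl⟩} :=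
        heq ▸ (h.sHat_iff hc ha hb' rfl rfl).2 h₂
      exact h₁.asymm hc hL' ((h.sHat_iff hc ha hb rfl rfl).1 hX)
  · rintro ⟨_, b, hb, rfl⟩ ⟨⟨_, a, ha, rfl⟩, hub, hleast⟩
    -- If `a ≺ b`, some `a'` in the model with `a ≺ a' ≺ b` shows that `a` is not an upper bound; if
    -- `b ≺ a`, some `a'` with `b ≺ a' ≺ a` is a smaller upper bound.
    rcases h.prec_or a ha.1 b hb.1 with hab | hba
    · obtain ⟨a', ha', h₁, h₂⟩ := h'.exists_right_between hc hM ha hb hab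
      have hlt := (classLT_iff (N := (M : Set C)) (X := ⟨_, a, ha, rfl⟩) (Y := ⟨_, a', ha', rfl⟩)
        hc hL' ha ha' rfl rfl).2 h₁
      rcases hub ⟨_, a', ha', rfl⟩ ((h.sHat_iff hc ha' hb rfl rfl).2 h₂) with hlt' | heq
      · exact hop.irrefl _ (hop.trans _ _ _ hlt hlt')
      · rw [heq] at hlt
        exact hop.irrefl _ hlt
    · obtain ⟨a', ha', h₁, h₂⟩ := h'.exists_right_between' hc hM ha hb hba
      have hlt := (classLT_iff (N := (M : Set C)) (X := ⟨_, a', ha', rfl⟩) (Y := ⟨_, a, ha, rfl⟩)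
        hc hL' ha' ha rfl rfl).2 h₂
      rcases hleast ⟨_, a', ha', rfl⟩ (by
        rintro ⟨_, x, hx, rfl⟩ hX
        rw [Set.mem_ofPred_eq, h.sHat_iff hc hx hb rfl rfl] at hX
        exact .inl ((classLT_iff hc hL' hx ha' rfl rfl).2 (hX.trans hc hL hx.1 h₁))) with hlt' | heq
      · exact hop.irrefl _ (hop.trans _ _ _ hlt hlt')
      · rw [heq] at hlt
        exact hop.irrefl _ hlt
  · rintro ⟨_, a, ha, rfl⟩ ⟨_, b, hb, rfl⟩ hX ⟨_, b', hb', rfl⟩ hlt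
    rw [Set.mem_ofPred_eq, h.sHat_iff hc ha hb rfl rfl] at hX
    rw [classLT_iff hc hL hb hb' rfl rfl] at hlt
    exact (h.sHat_iff hc ha hb' rfl rfl).2 (hX.trans hc hL ha.1 hlt)
  · rintro ⟨_, a, ha, rfl⟩ ⟨_, a', ha', rfl⟩ hlt
    rw [classLT_iff hc hL' ha ha' rfl rfl] at hlt
    refine Set.ssubset_iff_subset_ne.2 ⟨?_, fun heq => ?_⟩
    · rintro ⟨_, b, hb, rfl⟩ hX
      rw [Set.mem_ofPred_eq, h.sHat_iff hc ha' hb rfl rfl] at hX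
      exact (h.sHat_iff hc ha hb rfl rfl).2 (hlt.trans hc hLp ha.1 hX)
    · obtain ⟨b, hb, h₁, h₂⟩ := h'.exists_left_between hc hM ha ha' hlt
      have hX : (⟨_, b, hb, rfl⟩ : q.classes (M : Set C)) ∈
          {Y | p.SHat q M ⟨_, a', ha', rfl⟩ Y} :=
        heq ▸ (h.sHat_iff hc ha hb rfl rfl).2 h₁
      exact h₂.asymm hc hL' ((h.sHat_iff hc ha' hb rfl rfl).1 hX)

/-- A realization `a` of `p` in the model lies on one side of `b`, and density between `a` and `b`
produces a second class of `q`. -/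
theorem Shuffled.locusIn_eq_empty (hc : CompactOver L A) (h : Shuffled p q)
    (hM : A ⊆ (M : Set C)) (h₁ : (q.classes (M : Set C)).encard = 1) :
    p.locusIn (M : Set C) = ∅ := by
  rw [Set.eq_empty_iff_forall_notMem]
  intro a ha
  obtain ⟨X, hX⟩ := Set.encard_eq_one.1 h₁
  have hXm : X ∈ q.classes (M : Set C) := hX ▸ mem_singleton X
  obtain ⟨b, hb, rfl⟩ := hXm
  have hall : ∀ b' ∈ q.locusIn M, Dep L A b b' := fun b' hb' => by
    have : q.cls M b' ∈ q.classes (M : Set C) := ⟨b', hb', rfl⟩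
    rw [hX, mem_singleton_iff] at this
    exact (cls_eq_iff hc h.linked hb hb').1 this.symm
  have hLq := h.linked.self_right hc
  rcases h.prec_or a ha.1 b hb.1 with hab | hba
  · obtain ⟨b', hb', -, hlt⟩ := h.exists_right_between' hc hM hb ha hab
    exact ((dep_iff_prec hc hLq hb'.1 hb.1).1 (hall b' hb')).2 hlt
  · obtain ⟨b', hb', hlt, -⟩ := h.exists_right_between hc hM hb ha hba
    exact ((dep_iff_prec hc hLq hb'.1 hb.1).1 (hall b' hb')).1 hlt

end SOPair
end StatOrd

theorem mainTheorem11 {L : FirstOrder.Language.{u, v}} {C : Type w} [L.Structure C]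
    [Nonempty C] (hC : StatOrd.IsSaturated L C) (A : Set C) (hA : #A < #C)
    (p q : StatOrd.SOPair L A) (hpq : p.DirectNonorth q) :
    -- the quotients by forking dependence are linear orders
    (∀ N : Set C, p.IsOrderedQuotient N ∧ q.IsOrderedQuotient N) ∧
    -- the forking non-orthogonal case
    (¬ StatOrd.ForkOrth p.type q.type →
      p.CanonicalIso q Set.univ ∧
      (StatOrd.IsConvexType p.type → StatOrd.IsConvexType q.type →
        ∀ M : L.ElementarySubstructure C, A ⊆ (M : Set C) →
          p.CanonicalIso q (M : Set C) ∧
          ∃ τ : OrderType.{w}, p.HasInvariant (M : Set C) τ ∧ q.HasInvariant (M : Set C) τ)) ∧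
    -- the shuffled case
    (p.DirectlyShuffled q → p.IsConvex → q.IsConvex →
      ∀ M : L.ElementarySubstructure C, A ⊆ (M : Set C) →
        (2 ≤ (q.classes (M : Set C)).encard →
          Infinite (p.classes (M : Set C)) ∧ Infinite (q.classes (M : Set C)) ∧
          StatOrd.IsShuffling (p.classLT (M : Set C)) (q.classLT (M : Set C))
            (p.SHat q (M : Set C))) ∧
        ((q.classes (M : Set C)).encard = 1 → p.locusIn (M : Set C) = ∅)) := by
  have hc := hC.compactOver hA
  have hL := hpq.linked hc
  have hL' := hL.symm hc
  have hord : ∀ N : Set C, p.IsOrderedQuotient N ∧ q.IsOrderedQuotient N := fun N =>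
    ⟨hL'.isOrderedQuotient hc N, hL.isOrderedQuotient hc N⟩
  refine ⟨hord, fun hf => ?_, fun hs hp hq M hM => ?_⟩
  · obtain ⟨h₁, h₂⟩ := StatOrd.SOPair.exists_dep_of_not_forkOrth hc hL hf
    refine ⟨StatOrd.SOPair.canonicalIso_of_exists_dep hc hL (fun a ha => ?_) (fun b hb => ?_),
      fun hp hq M hM => ?_⟩
    · obtain ⟨b, hb, hab⟩ := h₁ a ha.1
      exact ⟨b, ⟨hb, trivial⟩, hab⟩
    · obtain ⟨a, ha, hab⟩ := h₂ b hb.1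
      exact ⟨a, ⟨ha, trivial⟩, hab⟩
    · have hiso : p.CanonicalIso q (M : Set C) :=
        StatOrd.SOPair.canonicalIso_of_exists_dep hc hL
          (fun a ha => let ⟨b, hb, hab⟩ := h₁ a ha.1
            StatOrd.SOPair.exists_dep_in_model hc hL hq hM ha hb hab)
          (fun b hb => let ⟨a, ha, hab⟩ := h₂ b hb.1
            StatOrd.SOPair.exists_dep_in_model hc hL' hp hM hb ha hab)
      exact ⟨hiso, hiso.exists_hasInvariant (hord _).1 (hord _).2⟩
  · have hsh := hs.shuffled hc hp hq
    refine ⟨fun h₂ => ?_, hsh.locusIn_eq_empty hc hM⟩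
    obtain ⟨b, hb, b', hb', hbb⟩ := hsh.exists_prec_of_two_le hc h₂
    obtain ⟨a, ha, hba, hab⟩ := hsh.exists_left_between hc hM hb hb' hbb
    exact ⟨hsh.infinite_left hc hM hb ha hba, hsh.infinite_right hc hM hb' ha hab,
      hsh.isShuffling hc hM hb' ha hab⟩
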